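/- Let $b\ge 3$ be an integer. For a Borel probability measure $\mu$ on $\mathbb{R}_+=[0,\infty)$ and $p>0$ put $\mathbf m_p(\mu)=\int x^p\,\mu(dx)$. For Borel probability measures $\mu,\nu$ on $\mathbb{R}_+$ let $\mathsf S_\mu\nu$ be the distribution of $b^{-1}\sum_{0\le j<b}W(j)Y(j)$, where the $2b$ random variables $W(0),\dots,W(b-1)$ (with distribution $\mu$) and $Y(0),\dots,Y(b-1)$ (with distribution $\nu$) are independent, and let $\mathsf T\mu$ be the weak limit of $\mathsf S_\mu^k\delta_1$ as $k\to\infty$, when it exists. Let $$\mathscr P_b=\{\mu:\ \mathbf m_1(\mu)=1,\ 1<\mathbf m_2(\mu)<b-1\},$$ $$\mathscr D_b=\{\mu:\ \mathbf m_1(\mu)=1,\ 1<\mathbf m_2(\mu)<w_2(b),\ \mathbf m_3(\mu)<w_3(b,\mathbf m_2(\mu))\},$$ where $$w_2(b)=\min\Bigl(b-1,\ b\,\frac{b^4-4b^2+12b-8}{b^4+8b^2-12b+4}\Bigr),$$ $$w_3(b,t)=\frac{b^2}{2}+\frac12\sqrt{\frac{b(b^4-4b^2+12b-8)-t(b^4+8b^2-12b+4)}{b-t}}.$$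 **Theorem (Central limit theorem).** Let $\mu\in\mathscr P_b$. Then all iterates $\mathsf T^n\mu$, $n\ge 0$, are well defined and belong to $\mathscr P_b$. For $n\ge 1$ put $\sigma_n=\bigl(\int (x-1)^2\,\mathsf T^n\mu(dx)\bigr)^{1/2}$. Then: 1. The limit of $(b-1)^{n/2}\sigma_n$ as $n\to\infty$ exists and is positive (and finite), and $\mathsf T^n\mu\to\delta_1$ weakly. 2. If $\mu\in\mathscr D_b$, then $\displaystyle\sup_{n\ge1}\int\Bigl(\frac{|x-1|}{\sigma_n}\Bigr)^3\,\mathsf T^n\mu(dx)<\infty$. 3. If there exists $p>2$ such that $\displaystyle\sup_{n\ge1}\int\Bigl(\frac{|x-1|}{\sigma_n}\Bigr)^p\,\mathsf T^n\mu(dx)<\infty$, then, whenever $W_n$ is a random variable with distribution $\mathsf T^n\mu$ for each $n$, $\dfrac{W_n-1}{\sigma_n}$ converges in distribution to $\mathcal N(0,1)$. -/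

import Mathlib

open MeasureTheory ProbabilityTheory Filter Topology
open scoped NNReal ENNReal

namespace Mandelbrot

/-- The moment of order `p` of a Borel probability measure on `[0, ∞)`, with values in `[0, ∞]`. -/
noncomputable def moment (p : ℝ) (μ : ProbabilityMeasure ℝ≥0) : ℝ≥0∞ :=
  ∫⁻ x : ℝ≥0, (x : ℝ≥0∞) ^ p ∂(μ : Measure ℝ≥0)

/-- The map `(W, Y) ↦ b⁻¹ ∑ j, W j * Y j`. -/
noncomputable def weightedMean (b : ℕ) (p : (Fin b → ℝ≥0) × (Fin b → ℝ≥0)) : ℝ≥0 :=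
  (b : ℝ≥0)⁻¹ * ∑ j, p.1 j * p.2 j

theorem measurable_weightedMean (b : ℕ) : Measurable (weightedMean b) := by
  unfold weightedMean
  fun_prop

/-- The smoothing transformation `S_μ`: `smoothing b μ ν` is the law of `b⁻¹ ∑ j, W j * Y j`, where
`W 0, …, W (b-1)` have law `μ`, `Y 0, …, Y (b-1)` have law `ν`, and these `2b` variables are
independent. -/
noncomputable def smoothing (b : ℕ) (μ ν : ProbabilityMeasure ℝ≥0) : ProbabilityMeasure ℝ≥0 :=
  ⟨((Measure.pi fun _ : Fin b => (μ : Measure ℝ≥0)).prod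
      (Measure.pi fun _ : Fin b => (ν : Measure ℝ≥0))).map (weightedMean b),
    Measure.isProbabilityMeasure_map (measurable_weightedMean b).aemeasurable⟩

/-- The transformation `T`: `T b μ` is the weak limit of `S_μ^k δ₁` as `k → ∞`
(an unspecified measure if there is no limit). -/
noncomputable def T (b : ℕ) (μ : ProbabilityMeasure ℝ≥0) : ProbabilityMeasure ℝ≥0 :=
  limUnder atTop fun k : ℕ => (smoothing b μ)^[k] (diracProba 1)

/-- The set `𝒫_b` of laws with mean one and second moment in `(1, b - 1)`. -/
def P (b : ℕ) : Set (ProbabilityMeasure ℝ≥0) :=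
  {μ | moment 1 μ = 1 ∧ 1 < moment 2 μ ∧ moment 2 μ < ENNReal.ofReal ((b : ℝ) - 1)}

noncomputable def w₂ (b : ℝ) : ℝ :=
  min (b - 1) (b * ((b ^ 4 - 4 * b ^ 2 + 12 * b - 8) / (b ^ 4 + 8 * b ^ 2 - 12 * b + 4)))

noncomputable def w₃ (b t : ℝ) : ℝ :=
  b ^ 2 / 2 + 1 / 2 * √((b * (b ^ 4 - 4 * b ^ 2 + 12 * b - 8)
    - t * (b ^ 4 + 8 * b ^ 2 - 12 * b + 4)) / (b - t))

/-- The set `𝒟_b` of laws with mean one, second moment in `(1, w₂ b)` and third moment less than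
`w₃ b (moment 2 μ)`. -/
def D (b : ℕ) : Set (ProbabilityMeasure ℝ≥0) :=
  {μ | moment 1 μ = 1 ∧ 1 < moment 2 μ ∧ moment 2 μ < ENNReal.ofReal (w₂ b) ∧
    moment 3 μ < ENNReal.ofReal (w₃ b (moment 2 μ).toReal)}

/-- `σ_n`, the standard deviation of `Tⁿ μ` when `Tⁿ μ` has mean one. -/
noncomputable def sigma (b : ℕ) (μ : ProbabilityMeasure ℝ≥0) (n : ℕ) : ℝ :=
  √(∫ x : ℝ≥0, ((x : ℝ) - 1) ^ 2 ∂((T b)^[n] μ : Measure ℝ≥0))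

/-- The normalized absolute moment `∫ (|x - 1| / σ_n) ^ p d(Tⁿ μ)`, with values in `[0, ∞]`. -/
noncomputable def normalizedMoment (b : ℕ) (μ : ProbabilityMeasure ℝ≥0) (p : ℝ) (n : ℕ) : ℝ≥0∞ :=
  ∫⁻ x : ℝ≥0, ENNReal.ofReal ((|(x : ℝ) - 1| / sigma b μ n) ^ p) ∂((T b)^[n] μ : Measure ℝ≥0)

end Mandelbrot

namespace Mandelbrot

/-! The limit `T b μ` exists because `smoothing b μ` contracts the distance `sup |cf ν s - cf ν' s|
/ s ^ 2` by the factor `(1 + var μ) / b < 1` (`norm_cf_smoothing_sub_le`). The limit is a fixed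
point of `smoothing b μ` (`smoothing_T`) with mean one and finite second moment. Comparing second
moments in the fixed-point equation gives `v' = v / (b - 1 - v)` for the variances (`var_T`). The
inverse variance thus follows an affine recursion with slope `b - 1`, solved in `inv_var_iterate`;
this gives invariance of `P b` and part 1.

For part 2, the fixed-point equation also gives `m' ≤ C / (b ^ 2 - m)` for third moments
(`moment_three_T_le`). The two roots of `x (b ^ 2 - x) = C` are real and distinct under the `w₂`
condition, and `w₃` is the larger one. Starting below it, the third moments eventually drop below
the midpoint `b ^ 2 / 2` (`exists_third_moment_bound`). From then on the absolute third central
moment divided by `σ_n ^ 3` satisfies a contracting affine inequality (`absThird_T_le`,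
`exists_absThird_le`).

For part 3, let `φ_n` be the characteristic function of the standardized law. Since `W Y - 1` equals
`(W - 1) + (Y - 1)` up to a product of small factors, `φ_{n+1}(s)` is close to `(φ_n(√(b-1) s/b)
φ_{n+1}(s/b)) ^ b`, an equation that the Gaussian satisfies exactly. The `p`-th moment bound
controls the difference from the Gaussian by `K |s| ^ q` with `2 < q ≤ 3`. Iterating the equation
multiplies this bound by powers of a constant that equals 1 at `q = 2` and is smaller for `q > 2`
(`norm_stdCf_succ_sub_le`, `mul_rpow_add_rpow_lt_one`, `tendsto_stdCf`). -/

/-! ### Smoothing as a rescaled sum of independent products. -/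

/-- The law of the product of independent variables with laws `μ` and `ν`. -/
noncomputable def mulLaw (μ ν : Measure ℝ≥0) : Measure ℝ≥0 :=
  (μ.prod ν).map fun p => p.1 * p.2

/-- The law of the sum of `n` independent variables with law `η`. -/
noncomputable def iidSum (η : Measure ℝ≥0) (n : ℕ) : Measure ℝ≥0 :=
  (Measure.pi fun _ : Fin n => η).map fun z => ∑ j, z j

instance (μ ν : Measure ℝ≥0) [IsProbabilityMeasure μ] [IsProbabilityMeasure ν] :
    IsProbabilityMeasure (mulLaw μ ν) :=
  Measure.isProbabilityMeasure_map (by fun_prop)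

instance (η : Measure ℝ≥0) [IsProbabilityMeasure η] (n : ℕ) :
    IsProbabilityMeasure (iidSum η n) :=
  Measure.isProbabilityMeasure_map (by fun_prop)

theorem coe_smoothing_eq_map_pi_prod (b : ℕ) (μ ν : ProbabilityMeasure ℝ≥0) :
    (smoothing b μ ν : Measure ℝ≥0) =
      (Measure.pi fun _ : Fin b => (μ : Measure ℝ≥0).prod (ν : Measure ℝ≥0)).map
        fun z => (b : ℝ≥0)⁻¹ * ∑ j, (z j).1 * (z j).2 := by
  have h := measurePreserving_arrowProdEquivProdArrow ℝ≥0 ℝ≥0 (Fin b)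
    (fun _ => (μ : Measure ℝ≥0)) (fun _ => (ν : Measure ℝ≥0))
  change (((Measure.pi fun _ : Fin b => (μ : Measure ℝ≥0)).prod
      (Measure.pi fun _ : Fin b => (ν : Measure ℝ≥0))).map (weightedMean b)) = _
  rw [← h.map_eq, Measure.map_map (measurable_weightedMean b) h.measurable]
  rfl

theorem coe_smoothing_eq_map_pi (b : ℕ) (μ ν : ProbabilityMeasure ℝ≥0) :
    (smoothing b μ ν : Measure ℝ≥0) =
      (Measure.pi fun _ : Fin b => mulLaw μ ν).map fun z => (b : ℝ≥0)⁻¹ * ∑ j, z j := by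
  rw [coe_smoothing_eq_map_pi_prod]
  have : (Measure.pi fun _ : Fin b => mulLaw (μ : Measure ℝ≥0) ν) =
      (Measure.pi fun _ : Fin b => (μ : Measure ℝ≥0).prod (ν : Measure ℝ≥0)).map
        fun z j => (z j).1 * (z j).2 := by
    unfold mulLaw
    rw [Measure.pi_map_pi (f := fun _ (p : ℝ≥0 × ℝ≥0) => p.1 * p.2) (fun _ => by fun_prop)]
  rw [this, Measure.map_map (by fun_prop) (by fun_prop)]
  rfl

theorem coe_smoothing_eq_map_iidSum (b : ℕ) (μ ν : ProbabilityMeasure ℝ≥0) :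
    (smoothing b μ ν : Measure ℝ≥0) =
      (iidSum (mulLaw μ ν) b).map fun x => (b : ℝ≥0)⁻¹ * x := by
  rw [coe_smoothing_eq_map_pi, iidSum, Measure.map_map (by fun_prop) (by fun_prop)]
  rfl

theorem lintegral_smoothing (b : ℕ) (μ ν : ProbabilityMeasure ℝ≥0) {f : ℝ≥0 → ℝ≥0∞}
    (hf : Measurable f) :
    ∫⁻ x, f x ∂(smoothing b μ ν : Measure ℝ≥0) =
      ∫⁻ x, f ((b : ℝ≥0)⁻¹ * x) ∂(iidSum (mulLaw μ ν) b) := by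
  rw [coe_smoothing_eq_map_iidSum, lintegral_map hf (by fun_prop)]

theorem lintegral_mulLaw (μ ν : Measure ℝ≥0) [SFinite μ] [SFinite ν] {f : ℝ≥0 → ℝ≥0∞}
    (hf : Measurable f) :
    ∫⁻ x, f x ∂(mulLaw μ ν) = ∫⁻ x, ∫⁻ y, f (x * y) ∂ν ∂μ := by
  rw [mulLaw, lintegral_map hf (by fun_prop), lintegral_prod _ (by fun_prop)]

theorem lintegral_iidSum_zero (η : Measure ℝ≥0) {f : ℝ≥0 → ℝ≥0∞} (hf : Measurable f) :
    ∫⁻ x, f x ∂(iidSum η 0) = f 0 := by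
  rw [iidSum, lintegral_map hf (by fun_prop)]
  simp

theorem lintegral_iidSum_succ (η : Measure ℝ≥0) [IsProbabilityMeasure η] (n : ℕ)
    {f : ℝ≥0 → ℝ≥0∞} (hf : Measurable f) :
    ∫⁻ x, f x ∂(iidSum η (n + 1)) = ∫⁻ x, ∫⁻ y, f (x + y) ∂(iidSum η n) ∂η := by
  have h := measurePreserving_piFinSuccAbove (fun _ : Fin (n + 1) => η) 0
  have key : ∫⁻ z, f (∑ j, z j) ∂(Measure.pi fun _ : Fin (n + 1) => η) =
      ∫⁻ p : ℝ≥0 × (Fin n → ℝ≥0), f (p.1 + ∑ j, p.2 j)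
        ∂(η.prod (Measure.pi fun _ : Fin n => η)) := by
    rw [← h.lintegral_comp (by fun_prop)]
    refine lintegral_congr fun z => ?_
    simp [Fin.sum_univ_succ, Fin.tail]
  rw [iidSum, lintegral_map hf (by fun_prop), key, lintegral_prod _ (by fun_prop)]
  refine lintegral_congr fun x => ?_
  rw [iidSum, lintegral_map (by fun_prop) (by fun_prop)]

/-! ### Integer moments of sums and of smoothed laws. -/

section Moments

variable {η : Measure ℝ≥0} [IsProbabilityMeasure η]

theorem lintegral_iidSum_one (h1 : ∫⁻ x, (x : ℝ≥0∞) ∂η = 1) (n : ℕ) :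
    ∫⁻ x, (x : ℝ≥0∞) ∂(iidSum η n) = n := by
  induction n with
  | zero => rw [lintegral_iidSum_zero η (by fun_prop)]; simp
  | succ n ih =>
    rw [lintegral_iidSum_succ η n (by fun_prop)]
    simp_rw [ENNReal.coe_add]
    simp_rw [lintegral_add_left (f := fun _ => (_ : ℝ≥0∞)) measurable_const]
    rw [lintegral_add_right _ (by fun_prop)]
    simp [ih, h1, add_comm]

theorem lintegral_iidSum_sq (h1 : ∫⁻ x, (x : ℝ≥0∞) ∂η = 1) (n : ℕ) :
    ∫⁻ x, (x : ℝ≥0∞) ^ 2 ∂(iidSum η n) =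
      n * ∫⁻ x, (x : ℝ≥0∞) ^ 2 ∂η + (n * (n - 1) : ℕ) := by
  induction n with
  | zero => rw [lintegral_iidSum_zero η (by fun_prop)]; simp
  | succ n ih =>
    rw [lintegral_iidSum_succ η n (by fun_prop)]
    have e (x y : ℝ≥0) : ((x + y : ℝ≥0) : ℝ≥0∞) ^ 2 = x ^ 2 + (2 * x * y + y ^ 2) := by
      push_cast; ring
    have inner (x : ℝ≥0) : ∫⁻ y, ((x + y : ℝ≥0) : ℝ≥0∞) ^ 2 ∂(iidSum η n) =
        x ^ 2 + (2 * n * x + ∫⁻ y, (y : ℝ≥0∞) ^ 2 ∂(iidSum η n)) := by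
      simp_rw [e]
      rw [lintegral_add_left measurable_const, lintegral_add_left (by fun_prop),
        lintegral_const_mul _ (by fun_prop), lintegral_iidSum_one h1]
      simp only [lintegral_const, measure_univ, mul_one]
      ring
    simp_rw [inner]
    rw [lintegral_add_left (by fun_prop), lintegral_add_left (by fun_prop),
      lintegral_const_mul _ (by fun_prop), h1, ih]
    simp only [lintegral_const, measure_univ, mul_one]
    have : ((n + 1) * (n + 1 - 1) : ℕ) = n * (n - 1) + 2 * n := by
      cases n <;> simp <;> ring
    rw [this]
    push_cast
    ring

/-- Expanding the cube gives `n` pure cubes, `3 n (n - 1)` terms with one repeated index and `n (n -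
1) (n - 2)` terms with distinct indices. The truncated subtractions are harmless because an earlier
factor vanishes whenever they truncate. -/
theorem lintegral_iidSum_cube (h1 : ∫⁻ x, (x : ℝ≥0∞) ∂η = 1) (n : ℕ) :
    ∫⁻ x, (x : ℝ≥0∞) ^ 3 ∂(iidSum η n) =
      n * ∫⁻ x, (x : ℝ≥0∞) ^ 3 ∂η + 3 * (n * (n - 1) : ℕ) * ∫⁻ x, (x : ℝ≥0∞) ^ 2 ∂η +
        (n * (n - 1) * (n - 2) : ℕ) := by
  induction n with
  | zero => rw [lintegral_iidSum_zero η (by fun_prop)]; simp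
  | succ n ih =>
    rw [lintegral_iidSum_succ η n (by fun_prop)]
    have e (x y : ℝ≥0) : ((x + y : ℝ≥0) : ℝ≥0∞) ^ 3 =
        x ^ 3 + (3 * x ^ 2 * y + (3 * x * y ^ 2 + y ^ 3)) := by
      push_cast; ring
    have inner (x : ℝ≥0) : ∫⁻ y, ((x + y : ℝ≥0) : ℝ≥0∞) ^ 3 ∂(iidSum η n) =
        x ^ 3 + (3 * n * x ^ 2 + (3 * (∫⁻ y, (y : ℝ≥0∞) ^ 2 ∂(iidSum η n)) * x +
          ∫⁻ y, (y : ℝ≥0∞) ^ 3 ∂(iidSum η n))) := by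
      simp_rw [e]
      rw [lintegral_add_left measurable_const, lintegral_add_left (by fun_prop),
        lintegral_add_left (by fun_prop),
        lintegral_const_mul _ (by fun_prop), lintegral_const_mul _ (by fun_prop),
        lintegral_iidSum_one h1]
      simp only [lintegral_const, measure_univ, mul_one]
      ring
    simp_rw [inner]
    rw [lintegral_add_left (by fun_prop), lintegral_add_left (by fun_prop),
      lintegral_add_left (by fun_prop),
      lintegral_const_mul _ (by fun_prop), lintegral_const_mul _ (by fun_prop), h1, ih,
      lintegral_iidSum_sq h1]
    simp only [lintegral_const, measure_univ, mul_one]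
    have e2 : ((n + 1) * (n + 1 - 1) : ℕ) = n * (n - 1) + 2 * n := by
      cases n <;> simp <;> ring
    have e3 : ((n + 1) * (n + 1 - 1) * (n + 1 - 2) : ℕ) =
        n * (n - 1) * (n - 2) + 3 * (n * (n - 1)) := by
      rcases n with _ | _ | n <;> simp <;> ring
    rw [e3, e2]
    push_cast
    ring

end Moments

theorem moment_one (μ : ProbabilityMeasure ℝ≥0) :
    moment 1 μ = ∫⁻ x : ℝ≥0, (x : ℝ≥0∞) ∂(μ : Measure ℝ≥0) := by
  simp [moment]

theorem moment_two (μ : ProbabilityMeasure ℝ≥0) :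
    moment 2 μ = ∫⁻ x : ℝ≥0, (x : ℝ≥0∞) ^ 2 ∂(μ : Measure ℝ≥0) := by
  simp [moment]

theorem moment_three (μ : ProbabilityMeasure ℝ≥0) :
    moment 3 μ = ∫⁻ x : ℝ≥0, (x : ℝ≥0∞) ^ 3 ∂(μ : Measure ℝ≥0) := by
  refine lintegral_congr fun x => ?_
  exact_mod_cast ENNReal.rpow_natCast (x : ℝ≥0∞) 3

theorem lintegral_mulLaw_pow (μ ν : Measure ℝ≥0) [SFinite μ] [SFinite ν] (k : ℕ) :
    ∫⁻ x, (x : ℝ≥0∞) ^ k ∂(mulLaw μ ν) =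
      (∫⁻ x, (x : ℝ≥0∞) ^ k ∂μ) * ∫⁻ x, (x : ℝ≥0∞) ^ k ∂ν := by
  rw [lintegral_mulLaw μ ν (by fun_prop)]
  simp_rw [ENNReal.coe_mul, mul_pow, lintegral_const_mul _
    (show Measurable fun y : ℝ≥0 => (y : ℝ≥0∞) ^ k by fun_prop)]
  rw [lintegral_mul_const _ (by fun_prop)]

theorem lintegral_smoothing_pow {b : ℕ} (hb : b ≠ 0) (μ ν : ProbabilityMeasure ℝ≥0) (k : ℕ) :
    ∫⁻ x : ℝ≥0, (x : ℝ≥0∞) ^ k ∂(smoothing b μ ν : Measure ℝ≥0) =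
      (b : ℝ≥0∞)⁻¹ ^ k * ∫⁻ x, (x : ℝ≥0∞) ^ k ∂(iidSum (mulLaw μ ν) b) := by
  rw [lintegral_smoothing b μ ν (by fun_prop)]
  simp_rw [ENNReal.coe_mul, mul_pow]
  rw [lintegral_const_mul _ (by fun_prop), ENNReal.coe_inv (by exact_mod_cast hb)]
  simp

theorem lintegral_mulLaw_id {μ ν : ProbabilityMeasure ℝ≥0} (hμ : moment 1 μ = 1)
    (hν : moment 1 ν = 1) : ∫⁻ x, (x : ℝ≥0∞) ∂(mulLaw (μ : Measure ℝ≥0) ν) = 1 := by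
  have := lintegral_mulLaw_pow (μ : Measure ℝ≥0) ν 1
  simpa [← moment_one, hμ, hν] using this

theorem moment_one_smoothing {b : ℕ} (hb : b ≠ 0) {μ ν : ProbabilityMeasure ℝ≥0}
    (hμ : moment 1 μ = 1) (hν : moment 1 ν = 1) : moment 1 (smoothing b μ ν) = 1 := by
  have := lintegral_smoothing_pow hb μ ν 1
  simp only [pow_one] at this
  rw [moment_one, this, lintegral_iidSum_one (lintegral_mulLaw_id hμ hν)]
  exact ENNReal.inv_mul_cancel (by exact_mod_cast hb) (by simp)

theorem moment_two_smoothing {b : ℕ} (hb : b ≠ 0) {μ ν : ProbabilityMeasure ℝ≥0}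
    (hμ : moment 1 μ = 1) (hν : moment 1 ν = 1) :
    moment 2 (smoothing b μ ν) =
      (b : ℝ≥0∞)⁻¹ ^ 2 * (b * (moment 2 μ * moment 2 ν) + (b * (b - 1) : ℕ)) := by
  rw [moment_two, lintegral_smoothing_pow hb, lintegral_iidSum_sq (lintegral_mulLaw_id hμ hν),
    lintegral_mulLaw_pow, ← moment_two, ← moment_two]

theorem moment_three_smoothing {b : ℕ} (hb : b ≠ 0) {μ ν : ProbabilityMeasure ℝ≥0}
    (hμ : moment 1 μ = 1) (hν : moment 1 ν = 1) :
    moment 3 (smoothing b μ ν) =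
      (b : ℝ≥0∞)⁻¹ ^ 3 * (b * (moment 3 μ * moment 3 ν) +
        3 * (b * (b - 1) : ℕ) * (moment 2 μ * moment 2 ν) + (b * (b - 1) * (b - 2) : ℕ)) := by
  rw [moment_three, lintegral_smoothing_pow hb, lintegral_iidSum_cube (lintegral_mulLaw_id hμ hν),
    lintegral_mulLaw_pow, lintegral_mulLaw_pow, ← moment_two, ← moment_two, ← moment_three,
    ← moment_three]

/-! ### Characteristic functions and weak convergence on the half-line. -/

/-- The characteristic function of a law on `[0, ∞)`. -/
noncomputable def cf (ν : ProbabilityMeasure ℝ≥0) (s : ℝ) : ℂ :=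
  ∫ x : ℝ≥0, Complex.exp (s * (x : ℝ) * Complex.I) ∂(ν : Measure ℝ≥0)

theorem charFun_map_coe (ν : ProbabilityMeasure ℝ≥0) (s : ℝ) :
    charFun ((ν : Measure ℝ≥0).map ((↑) : ℝ≥0 → ℝ)) s = cf ν s := by
  rw [charFun_apply_real, integral_map (by fun_prop) (by fun_prop), cf]

theorem norm_cexp_mul_I (x y : ℝ) : ‖Complex.exp (x * y * Complex.I)‖ = 1 := by
  rw [← Complex.ofReal_mul, Complex.norm_exp_ofReal_mul_I]

theorem norm_cf_le_one (ν : ProbabilityMeasure ℝ≥0) (s : ℝ) : ‖cf ν s‖ ≤ 1 := by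
  refine (norm_integral_le_of_norm_le_const (C := 1) (ae_of_all _ fun x => ?_)).trans (by simp)
  exact (norm_cexp_mul_I _ _).le

theorem ext_of_cf {μ ν : ProbabilityMeasure ℝ≥0} (h : ∀ s, cf μ s = cf ν s) : μ = ν := by
  have hm : (μ : Measure ℝ≥0).map ((↑) : ℝ≥0 → ℝ) = (ν : Measure ℝ≥0).map ((↑) : ℝ≥0 → ℝ) := by
    have := Measure.isProbabilityMeasure_map (μ := (μ : Measure ℝ≥0)) (f := ((↑) : ℝ≥0 → ℝ))
      (by fun_prop)
    have := Measure.isProbabilityMeasure_map (μ := (ν : Measure ℝ≥0)) (f := ((↑) : ℝ≥0 → ℝ))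
      (by fun_prop)
    refine Measure.ext_of_charFun (funext fun s => ?_)
    rw [charFun_map_coe, charFun_map_coe, h]
  have he : MeasurableEmbedding ((↑) : ℝ≥0 → ℝ) :=
    NNReal.isClosedEmbedding_coe.measurableEmbedding
  refine Subtype.ext ?_
  change (μ : Measure ℝ≥0) = ν
  rw [← he.comap_map (μ : Measure ℝ≥0), ← he.comap_map (ν : Measure ℝ≥0), hm]

/-- The `b` pairs `(W j, Y j)` are independent, so the exponential factorizes. The integral is kept
over pairs because the central limit argument works with the product `W Y` directly. -/
theorem cf_smoothing_eq_prod (b : ℕ) (μ ν : ProbabilityMeasure ℝ≥0) (s : ℝ) :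
    cf (smoothing b μ ν) s =
      (∫ p : ℝ≥0 × ℝ≥0, Complex.exp ((s / b : ℝ) * ((p.1 * p.2 : ℝ≥0) : ℝ) * Complex.I)
        ∂((μ : Measure ℝ≥0).prod (ν : Measure ℝ≥0))) ^ b := by
  rw [cf, coe_smoothing_eq_map_pi_prod, integral_map (by fun_prop) (by fun_prop)]
  have := integral_fintype_prod_eq_prod (𝕜 := ℂ) (ι := Fin b)
    (μ := fun _ => (μ : Measure ℝ≥0).prod (ν : Measure ℝ≥0))
    (fun _ p => Complex.exp ((s / b : ℝ) * ((p.1 * p.2 : ℝ≥0) : ℝ) * Complex.I))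
  rw [Finset.prod_const, Finset.card_fin] at this
  rw [← this]
  congr 1
  ext z
  rw [← Complex.exp_sum]
  congr 1
  rw [← Finset.sum_mul, ← Finset.mul_sum]
  push_cast
  ring

theorem cf_smoothing (b : ℕ) (μ ν : ProbabilityMeasure ℝ≥0) (s : ℝ) :
    cf (smoothing b μ ν) s = (∫ w : ℝ≥0, cf ν (s / b * w) ∂(μ : Measure ℝ≥0)) ^ b := by
  rw [cf_smoothing_eq_prod, integral_prod]
  · simp only [cf]
    congr 2
    ext w
    congr 1
    ext y
    push_cast
    ring_nf
  · refine Integrable.of_bound (C := 1) (by fun_prop) (ae_of_all _ fun p => ?_)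
    exact (norm_cexp_mul_I _ _).le

open BoundedContinuousFunction in
theorem tendsto_cf {ι : Type*} {l : Filter ι} {ν : ι → ProbabilityMeasure ℝ≥0}
    {ν₀ : ProbabilityMeasure ℝ≥0} (h : Tendsto ν l (𝓝 ν₀)) (s : ℝ) :
    Tendsto (fun k => cf (ν k) s) l (𝓝 (cf ν₀ s)) := by
  rw [ProbabilityMeasure.tendsto_iff_forall_integral_rclike_tendsto ℂ] at h
  exact h (BoundedContinuousFunction.ofNormedAddCommGroup
    (fun x : ℝ≥0 => Complex.exp (s * (x : ℝ) * Complex.I)) (by fun_prop) 1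
    fun x => (norm_cexp_mul_I _ _).le)

theorem measure_Icc_compl_le (ν : ProbabilityMeasure ℝ≥0) (M : ℝ≥0) (hM : M ≠ 0) :
    (ν : Measure ℝ≥0) (Set.Icc 0 M)ᶜ ≤ moment 1 ν / M := by
  rw [moment_one]
  refine (measure_mono ?_).trans (meas_ge_le_lintegral_div (by fun_prop) (by simpa using hM)
    (by simp))
  intro x hx
  simp only [Set.mem_compl_iff, Set.mem_Icc, zero_le, true_and, not_le] at hx
  simpa using hx.le

/-- Markov's inequality, with the same bound on all means, gives tightness. -/
theorem isTightMeasureSet_of_moment_one_le {ν : ℕ → ProbabilityMeasure ℝ≥0}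
    (h : ∀ k, moment 1 (ν k) ≤ 1) :
    IsTightMeasureSet {((ρ : ProbabilityMeasure ℝ≥0) : Measure ℝ≥0) | ρ ∈ Set.range ν} := by
  rw [isTightMeasureSet_iff_exists_isCompact_measure_compl_le]
  intro ε hε
  obtain ⟨M, hM0, hM⟩ : ∃ M : ℝ≥0, M ≠ 0 ∧ (M : ℝ≥0∞)⁻¹ ≤ ε := by
    obtain ⟨n, hn⟩ := ENNReal.exists_inv_nat_lt hε.ne'
    refine ⟨n + 1, by positivity, le_trans ?_ hn.le⟩
    exact ENNReal.inv_le_inv.2 (by push_cast; exact le_self_add)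
  refine ⟨Set.Icc 0 M, isCompact_Icc, ?_⟩
  rintro _ ⟨_, ⟨k, rfl⟩, rfl⟩
  refine (measure_Icc_compl_le _ M hM0).trans (le_trans ?_ hM)
  rw [← one_div]
  gcongr
  exact h k

/-- A sequence of laws of bounded mean whose characteristic functions converge pointwise converges
weakly. -/
theorem exists_tendsto_of_tendsto_cf {ν : ℕ → ProbabilityMeasure ℝ≥0}
    (h : ∀ k, moment 1 (ν k) ≤ 1)
    (hc : ∀ s, ∃ z, Tendsto (fun k => cf (ν k) s) atTop (𝓝 z)) :
    ∃ ν₀, Tendsto ν atTop (𝓝 ν₀) := by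
  have hK := isCompact_closure_of_isTightMeasureSet (isTightMeasureSet_of_moment_one_le h)
  have hmem : ∀ᶠ k in atTop, ν k ∈ closure (Set.range ν) :=
    Eventually.of_forall fun k => subset_closure ⟨k, rfl⟩
  obtain ⟨ν₀, -, hν₀⟩ := hK.exists_mapClusterPt (f := atTop) (u := ν)
    (by simpa [Filter.le_principal_iff] using hmem)
  -- Along an ultrafilter converging to a cluster point, the characteristic functions have the limit
  -- they have along the whole sequence. All cluster points therefore coincide, and relative
  -- compactness turns uniqueness into convergence.
  have key (ρ) (hρ : MapClusterPt ρ atTop ν) (s : ℝ) :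
      Tendsto (fun k => cf (ν k) s) atTop (𝓝 (cf ρ s)) := by
    obtain ⟨z, hz⟩ := hc s
    obtain ⟨U, hU, hUρ⟩ := mapClusterPt_iff_ultrafilter.1 hρ
    have h1 := tendsto_cf hUρ s
    rwa [tendsto_nhds_unique h1 (hz.mono_left hU)]
  refine ⟨ν₀, hK.tendsto_nhds_of_unique_mapClusterPt hmem fun ρ _ hρ => ext_of_cf fun s => ?_⟩
  exact tendsto_nhds_unique (key ρ hρ s) (key ν₀ hν₀ s)

/-- Integrals of nonnegative continuous functions are lower semicontinuous under weak convergence,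
by the portmanteau inequality on open sets. -/
theorem lintegral_pow_le_of_tendsto {ν : ℕ → ProbabilityMeasure ℝ≥0}
    {ν₀ : ProbabilityMeasure ℝ≥0} (h : Tendsto ν atTop (𝓝 ν₀)) (j : ℕ) {C : ℝ≥0∞}
    (hC : ∀ k, ∫⁻ x, (x : ℝ≥0∞) ^ j ∂(ν k : Measure ℝ≥0) ≤ C) :
    ∫⁻ x, (x : ℝ≥0∞) ^ j ∂(ν₀ : Measure ℝ≥0) ≤ C := by
  have e (x : ℝ≥0) : (x : ℝ≥0∞) ^ j = ENNReal.ofReal ((x : ℝ) ^ j) := by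
    rw [ENNReal.ofReal_pow x.coe_nonneg, ENNReal.ofReal_coe_nnreal]
  simp_rw [e] at hC ⊢
  refine (lintegral_le_liminf_lintegral_of_forall_isOpen_measure_le_liminf_measure
    (μs := fun k => (ν k : Measure ℝ≥0)) (f := fun x : ℝ≥0 => (x : ℝ) ^ j) (by fun_prop)
    (fun x => by positivity)
    (fun G hG => ProbabilityMeasure.le_liminf_measure_open_of_tendsto h hG)).trans ?_
  refine (liminf_le_liminf (Eventually.of_forall hC)).trans ?_
  simp

theorem continuous_smoothing (b : ℕ) (μ : ProbabilityMeasure ℝ≥0) :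
    Continuous (smoothing b μ) := by
  have h1 : Continuous fun ν : ProbabilityMeasure ℝ≥0 =>
      (ProbabilityMeasure.pi fun _ : Fin b => μ).prod (ProbabilityMeasure.pi fun _ : Fin b => ν) :=
    ProbabilityMeasure.continuous_prod.comp (continuous_const.prodMk
      (ProbabilityMeasure.continuous_pi.comp (continuous_pi fun _ => continuous_id)))
  have hc : Continuous (weightedMean b) := by
    unfold weightedMean
    fun_prop
  exact (ProbabilityMeasure.continuous_map hc).comp h1

theorem memLp_coe {ν : ProbabilityMeasure ℝ≥0} {k : ℕ} (hk : k ≠ 0)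
    (h : ∫⁻ x, (x : ℝ≥0∞) ^ k ∂(ν : Measure ℝ≥0) < ⊤) :
    MemLp (fun x : ℝ≥0 => (x : ℝ)) k (ν : Measure ℝ≥0) := by
  refine ⟨by fun_prop, ?_⟩
  rw [eLpNorm_lt_top_iff_lintegral_rpow_enorm_lt_top (by simpa using hk) (by simp)]
  simpa using h

theorem integral_pow_eq_toReal (ν : ProbabilityMeasure ℝ≥0) (k : ℕ) :
    ∫ x : ℝ≥0, (x : ℝ) ^ k ∂(ν : Measure ℝ≥0) =
      (∫⁻ x, (x : ℝ≥0∞) ^ k ∂(ν : Measure ℝ≥0)).toReal := by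
  rw [integral_eq_lintegral_of_nonneg_ae (ae_of_all _ fun x => by positivity) (by fun_prop)]
  congr 1
  refine lintegral_congr fun x => ?_
  rw [ENNReal.ofReal_pow x.coe_nonneg, ENNReal.ofReal_coe_nnreal]

/-! ### Taylor bounds for the exponential, and second moments. -/

theorem norm_cexp_mul_I_sub_one_sub_le (x : ℝ) :
    ‖Complex.exp (x * Complex.I) - 1 - x * Complex.I‖ ≤ 4 * x ^ 2 := by
  rcases le_total |x| 1 with h | h
  · have := Complex.exp_bound (x := x * Complex.I) (by simpa using h) (n := 2) (by norm_num)
    simp [Finset.sum_range_succ] at this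
    rw [← sub_sub] at this
    refine this.trans ?_
    norm_num
    nlinarith [sq_nonneg x]
  · have h2 : |x| ≤ x ^ 2 := by rw [← sq_abs]; nlinarith
    calc _ ≤ ‖Complex.exp (x * Complex.I)‖ + ‖(1 : ℂ)‖ + ‖x * Complex.I‖ :=
          (norm_sub_le _ _).trans (by gcongr; exact norm_sub_le _ _)
      _ = 2 + |x| := by rw [Complex.norm_exp_ofReal_mul_I]; simp; norm_num
      _ ≤ _ := by nlinarith

/-- For `|x| ≤ 1` the cubic remainder is at most `|x| ^ q` as `q ≤ 3`; for `|x| ≥ 1` each term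
separately is at most a multiple of `x ^ 2 ≤ |x| ^ q`. -/
theorem norm_cexp_mul_I_sub_taylor_two_le (x : ℝ) {q : ℝ} (hq2 : 2 ≤ q) (hq3 : q ≤ 3) :
    ‖Complex.exp (x * Complex.I) - 1 - x * Complex.I + x ^ 2 / 2‖ ≤ 4 * |x| ^ q := by
  rcases le_total |x| 1 with h | h
  · have := Complex.exp_bound (x := x * Complex.I) (by simpa using h) (n := 3) (by norm_num)
    simp [Finset.sum_range_succ, mul_pow, Nat.factorial] at this
    have e : Complex.exp (x * Complex.I) - 1 - x * Complex.I + x ^ 2 / 2 =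
        Complex.exp (x * Complex.I) - (1 + x * Complex.I + -(x : ℂ) ^ 2 / 2) := by ring
    rw [e]
    refine this.trans ?_
    have h3 : |x| ^ 3 ≤ |x| ^ q := by
      rcases eq_or_ne x 0 with rfl | hx
      · simp; positivity
      · rw [← Real.rpow_natCast]
        exact Real.rpow_le_rpow_of_exponent_ge (abs_pos.2 hx) h (by simpa using hq3)
    have : 0 ≤ |x| ^ q := by positivity
    norm_num
    linarith
  · have h2 : |x| ≤ x ^ 2 := by rw [← sq_abs]; nlinarith
    have hq : x ^ 2 ≤ |x| ^ q := by
      rw [← sq_abs, ← Real.rpow_natCast]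
      exact Real.rpow_le_rpow_of_exponent_le h (by simpa using hq2)
    calc _ ≤ ‖Complex.exp (x * Complex.I)‖ + ‖(1 : ℂ)‖ + ‖x * Complex.I‖ + ‖(x : ℂ) ^ 2 / 2‖ :=
          (norm_add_le _ _).trans (by
            gcongr; exact (norm_sub_le _ _).trans (by gcongr; exact norm_sub_le _ _))
      _ = 2 + |x| + x ^ 2 / 2 := by rw [Complex.norm_exp_ofReal_mul_I]; simp; norm_num
      _ ≤ _ := by nlinarith

/-- The variance of a law with mean one. -/
noncomputable def var (ν : ProbabilityMeasure ℝ≥0) : ℝ :=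
  ∫ x : ℝ≥0, ((x : ℝ) - 1) ^ 2 ∂(ν : Measure ℝ≥0)

section SecondMoment

variable {ν : ProbabilityMeasure ℝ≥0}

theorem memLp_two (h2 : moment 2 ν < ⊤) :
    MemLp (fun x : ℝ≥0 => (x : ℝ)) 2 (ν : Measure ℝ≥0) := by
  simpa using memLp_coe (k := 2) (by norm_num) (by rwa [← moment_two])

theorem memLp_sub_one_two (h2 : moment 2 ν < ⊤) :
    MemLp (fun x : ℝ≥0 => (x : ℝ) - 1) 2 (ν : Measure ℝ≥0) :=
  (memLp_two h2).sub (memLp_const 1)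

theorem integrable_coe (h2 : moment 2 ν < ⊤) :
    Integrable (fun x : ℝ≥0 => (x : ℝ)) (ν : Measure ℝ≥0) :=
  (memLp_two h2).integrable (by norm_num)

theorem integral_coe (h1 : moment 1 ν = 1) : ∫ x : ℝ≥0, (x : ℝ) ∂(ν : Measure ℝ≥0) = 1 := by
  have := integral_pow_eq_toReal ν 1
  simpa [← moment_one, h1] using this

theorem integral_coe_sub_one (h1 : moment 1 ν = 1) (h2 : moment 2 ν < ⊤) :
    ∫ x : ℝ≥0, ((x : ℝ) - 1) ∂(ν : Measure ℝ≥0) = 0 := by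
  rw [integral_sub (integrable_coe h2) (integrable_const _), integral_coe h1]
  simp

theorem integrable_sub_one_sq (h2 : moment 2 ν < ⊤) :
    Integrable (fun x : ℝ≥0 => ((x : ℝ) - 1) ^ 2) (ν : Measure ℝ≥0) :=
  (memLp_sub_one_two h2).integrable_sq

theorem var_nonneg : 0 ≤ var ν := integral_nonneg fun _ => by positivity

theorem toReal_moment_two (h1 : moment 1 ν = 1) (h2 : moment 2 ν < ⊤) :
    (moment 2 ν).toReal = 1 + var ν := by
  rw [moment_two, ← integral_pow_eq_toReal]
  have e (x : ℝ≥0) : (x : ℝ) ^ 2 = ((x : ℝ) - 1) ^ 2 + (2 * x - 1) := by ring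
  have hk : Integrable (fun x : ℝ≥0 => 2 * (x : ℝ) - 1) (ν : Measure ℝ≥0) :=
    ((integrable_coe h2).const_mul 2).sub (integrable_const _)
  simp_rw [e]
  rw [integral_add (integrable_sub_one_sq h2) hk,
    integral_sub ((integrable_coe h2).const_mul 2) (integrable_const _), integral_const_mul,
    integral_coe h1, var]
  simp
  ring

theorem moment_two_eq (h1 : moment 1 ν = 1) (h2 : moment 2 ν < ⊤) :
    moment 2 ν = ENNReal.ofReal (1 + var ν) := by
  rw [← toReal_moment_two h1 h2, ENNReal.ofReal_toReal h2.ne]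

/-- After factoring out the phase at 1, the first-order term integrates to zero because the mean is
one, leaving only the quadratic remainder. -/
theorem norm_cf_sub_le (h1 : moment 1 ν = 1) (h2 : moment 2 ν < ⊤) (s : ℝ) :
    ‖cf ν s - Complex.exp (s * Complex.I)‖ ≤ 4 * var ν * s ^ 2 := by
  have hi : Integrable (fun x : ℝ≥0 => Complex.exp ((s * ((x : ℝ) - 1) : ℝ) * Complex.I))
      (ν : Measure ℝ≥0) :=
    Integrable.of_bound (C := 1) (by fun_prop)
      (ae_of_all _ fun x => (Complex.norm_exp_ofReal_mul_I _).le)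
  have hj : Integrable (fun x : ℝ≥0 => (((s * ((x : ℝ) - 1) : ℝ) : ℂ) * Complex.I))
      (ν : Measure ℝ≥0) :=
    (((memLp_sub_one_two h2).integrable (by norm_num)).const_mul s).ofReal.mul_const _
  have hk : Integrable (fun x : ℝ≥0 => Complex.exp ((s * ((x : ℝ) - 1) : ℝ) * Complex.I) - 1)
      (ν : Measure ℝ≥0) := hi.sub (integrable_const _)
  have e : cf ν s - Complex.exp (s * Complex.I) = Complex.exp (s * Complex.I) *
      ∫ x : ℝ≥0, (Complex.exp ((s * ((x : ℝ) - 1) : ℝ) * Complex.I) - 1 -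
        (s * ((x : ℝ) - 1) : ℝ) * Complex.I) ∂(ν : Measure ℝ≥0) := by
    rw [integral_sub hk hj, integral_sub hi (integrable_const _),
      integral_mul_const, integral_complex_ofReal, integral_const_mul, integral_coe_sub_one h1 h2,
      mul_sub, mul_sub, ← integral_const_mul, cf]
    simp only [← Complex.exp_add]
    simp
    congr 1
    ext x
    ring_nf
  rw [e, norm_mul, Complex.norm_exp_ofReal_mul_I, one_mul]
  refine (norm_integral_le_integral_norm _).trans ?_
  rw [show 4 * var ν * s ^ 2 = ∫ x : ℝ≥0, 4 * (s * ((x : ℝ) - 1)) ^ 2 ∂(ν : Measure ℝ≥0) by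
    simp_rw [mul_pow]; rw [integral_const_mul, integral_const_mul, var]; ring]
  refine integral_mono (hk.sub hj).norm ?_
    fun x => norm_cexp_mul_I_sub_one_sub_le _
  simp_rw [mul_pow]
  exact ((integrable_sub_one_sq h2).const_mul _).const_mul _

end SecondMoment

/-! ### Contraction of the smoothing transformation. -/

theorem norm_pow_sub_pow_le_mul {x y : ℂ} (hx : ‖x‖ ≤ 1) (hy : ‖y‖ ≤ 1) (n : ℕ) :
    ‖x ^ n - y ^ n‖ ≤ n * ‖x - y‖ := by
  induction n with
  | zero => simp
  | succ n ih =>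
    have e : x ^ (n + 1) - y ^ (n + 1) = x ^ n * (x - y) + (x ^ n - y ^ n) * y := by ring
    rw [e]
    calc _ ≤ ‖x ^ n‖ * ‖x - y‖ + ‖x ^ n - y ^ n‖ * ‖y‖ := by
          refine (norm_add_le _ _).trans ?_
          rw [norm_mul, norm_mul]
      _ ≤ 1 * ‖x - y‖ + n * ‖x - y‖ * 1 := by
          gcongr
          rw [norm_pow]
          exact pow_le_one₀ (norm_nonneg _) hx
      _ = _ := by push_cast; ring

@[fun_prop]
theorem measurable_cf (ν : ProbabilityMeasure ℝ≥0) : Measurable (cf ν) := by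
  have : cf ν = charFun ((ν : Measure ℝ≥0).map ((↑) : ℝ≥0 → ℝ)) :=
    funext fun s => (charFun_map_coe ν s).symm
  rw [this]
  have := Measure.isProbabilityMeasure_map (μ := (ν : Measure ℝ≥0)) (f := ((↑) : ℝ≥0 → ℝ))
    (by fun_prop)
  fun_prop

theorem integrable_cf_comp (μ ν : ProbabilityMeasure ℝ≥0) (s : ℝ) :
    Integrable (fun w : ℝ≥0 => cf ν (s * w)) (μ : Measure ℝ≥0) :=
  Integrable.of_bound (C := 1)
    (((measurable_cf ν).comp (by fun_prop)).aestronglyMeasurable)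
    (ae_of_all _ fun _ => norm_cf_le_one _ _)

theorem norm_integral_cf_comp_le_one (μ ν : ProbabilityMeasure ℝ≥0) (s : ℝ) :
    ‖∫ w : ℝ≥0, cf ν (s * w) ∂(μ : Measure ℝ≥0)‖ ≤ 1 :=
  (norm_integral_le_of_norm_le_const (C := 1)
    (ae_of_all _ fun _ => norm_cf_le_one _ _)).trans (by simp)

/-- The `b`-th power costs a factor `b`, the scaling `s / b` gains `b ^ 2`, and integrating `w ^ 2`
produces the second moment `1 + var μ`. -/
theorem norm_cf_smoothing_sub_le {b : ℕ} (hb : b ≠ 0) {μ ν ν' : ProbabilityMeasure ℝ≥0}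
    (h1 : moment 1 μ = 1) (h2 : moment 2 μ < ⊤) {K : ℝ}
    (hK : ∀ s, ‖cf ν s - cf ν' s‖ ≤ K * s ^ 2) (s : ℝ) :
    ‖cf (smoothing b μ ν) s - cf (smoothing b μ ν') s‖ ≤ K * ((1 + var μ) / b) * s ^ 2 := by
  rw [cf_smoothing, cf_smoothing]
  refine (norm_pow_sub_pow_le_mul (norm_integral_cf_comp_le_one _ _ _)
    (norm_integral_cf_comp_le_one _ _ _) b).trans ?_
  rw [← integral_sub (integrable_cf_comp _ _ _) (integrable_cf_comp _ _ _)]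
  have hsq : Integrable (fun w : ℝ≥0 => (w : ℝ) ^ 2) (μ : Measure ℝ≥0) :=
    (memLp_two h2).integrable_sq
  have : ‖∫ w : ℝ≥0, (cf ν (s / b * w) - cf ν' (s / b * w)) ∂(μ : Measure ℝ≥0)‖ ≤
      ∫ w : ℝ≥0, K * (s / b) ^ 2 * (w : ℝ) ^ 2 ∂(μ : Measure ℝ≥0) := by
    refine norm_integral_le_of_norm_le (hsq.const_mul _) (ae_of_all _ fun w => ?_)
    refine (hK _).trans_eq ?_
    ring
  rw [integral_const_mul, integral_pow_eq_toReal, ← moment_two, toReal_moment_two h1 h2] at this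
  have hb' : (b : ℝ) ≠ 0 := by exact_mod_cast hb
  calc _ ≤ b * (K * (s / b) ^ 2 * (1 + var μ)) := by gcongr
    _ = _ := by field_simp

theorem moment_diracProba_one (p : ℝ) : moment p (diracProba 1) = 1 := by
  simp [moment, diracProba]

theorem cf_diracProba_one (s : ℝ) : cf (diracProba 1) s = Complex.exp (s * Complex.I) := by
  simp [cf, diracProba]

theorem moment_two_smoothing_ofReal {b : ℕ} (hb : b ≠ 0) {μ ν : ProbabilityMeasure ℝ≥0}
    (hμ : moment 1 μ = 1) (hν : moment 1 ν = 1) {t y : ℝ} (ht : 0 ≤ t) (hy : 0 ≤ y)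
    (hμ2 : moment 2 μ = ENNReal.ofReal t) (hν2 : moment 2 ν = ENNReal.ofReal y) :
    moment 2 (smoothing b μ ν) = ENNReal.ofReal ((t * y + (b - 1)) / b) := by
  have hb' : (0 : ℝ) < b := by positivity
  have hb1 : (1 : ℝ) ≤ b := by exact_mod_cast Nat.one_le_iff_ne_zero.2 hb
  have e1 : ((b * (b - 1) : ℕ) : ℝ≥0∞) = ENNReal.ofReal (b * (b - 1)) := by
    rw [← ENNReal.ofReal_natCast]
    push_cast [Nat.one_le_iff_ne_zero.2 hb]
    rfl
  have e2 : (b : ℝ≥0∞)⁻¹ = ENNReal.ofReal ((b : ℝ)⁻¹) := by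
    rw [ENNReal.ofReal_inv_of_pos hb', ENNReal.ofReal_natCast]
  rw [moment_two_smoothing hb hμ hν, hμ2, hν2, e1, e2, ← ENNReal.ofReal_natCast b,
    ← ENNReal.ofReal_mul ht, ← ENNReal.ofReal_mul hb'.le,
    ← ENNReal.ofReal_add (by positivity) (mul_nonneg hb'.le (by linarith)),
    ← ENNReal.ofReal_pow (by positivity), ← ENNReal.ofReal_mul (by positivity)]
  congr 1
  field_simp

/-- Bounded second moments prevent loss of mean: `x ≤ min x M + x ^ 2 / M`, and the truncation `min
x M` is a legitimate test function for weak convergence. Then `M` tends to infinity. -/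
theorem one_le_moment_one_of_tendsto {ν : ℕ → ProbabilityMeasure ℝ≥0}
    {ν₀ : ProbabilityMeasure ℝ≥0} (h : Tendsto ν atTop (𝓝 ν₀)) (h1 : ∀ k, moment 1 (ν k) = 1)
    {C : ℝ≥0∞} (hC : C ≠ ⊤) (h2 : ∀ k, moment 2 (ν k) ≤ C) : 1 ≤ moment 1 ν₀ := by
  have key (M : ℕ) (hM : M ≠ 0) : 1 ≤ moment 1 ν₀ + C / M := by
    let f : BoundedContinuousFunction ℝ≥0 ℝ≥0 :=
      BoundedContinuousFunction.mkOfBound ⟨fun x => min x M, by fun_prop⟩ M (fun x y => by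
        rw [NNReal.dist_eq, abs_le]
        have h1 : min x (M : ℝ≥0) ≤ M := min_le_right _ _
        have h2 : min y (M : ℝ≥0) ≤ M := min_le_right _ _
        have h1' := NNReal.coe_le_coe.2 h1
        have h2' := NNReal.coe_le_coe.2 h2
        have h3 := (min x (M : ℝ≥0)).coe_nonneg
        have h4 := (min y (M : ℝ≥0)).coe_nonneg
        constructor <;> simp only [ContinuousMap.coe_mk] at * <;> linarith [NNReal.coe_natCast M])
    have hf (x : ℝ≥0) : f x = min x M := rfl
    have hlim := (ProbabilityMeasure.tendsto_iff_forall_lintegral_tendsto.1 h f)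
    have hle (k : ℕ) : 1 ≤ ∫⁻ x, f x ∂(ν k : Measure ℝ≥0) + C / M := by
      calc (1 : ℝ≥0∞) = ∫⁻ x, (x : ℝ≥0∞) ∂(ν k : Measure ℝ≥0) := by rw [← moment_one, h1]
        _ ≤ ∫⁻ x, (f x + (x : ℝ≥0∞) ^ 2 * (M : ℝ≥0∞)⁻¹) ∂(ν k : Measure ℝ≥0) := by
            refine lintegral_mono fun x => ?_
            simp only [hf]
            rcases le_total x M with hx | hx
            · rw [min_eq_left hx]; exact le_self_add
            · refine le_add_left ?_
              rw [← ENNReal.coe_natCast, ← ENNReal.coe_inv (by exact_mod_cast hM),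
                ← ENNReal.coe_pow, ← ENNReal.coe_mul, ENNReal.coe_le_coe, sq, mul_assoc]
              refine le_mul_of_one_le_right zero_le ?_
              rw [← div_eq_mul_inv, one_le_div₀ (by positivity)]
              exact hx
        _ ≤ _ := by
            rw [lintegral_add_left (by fun_prop), lintegral_mul_const _ (by fun_prop),
              ← moment_two, ← div_eq_mul_inv]
            gcongr
            exact h2 k
    have := ge_of_tendsto' (hlim.add_const (C / M)) hle
    refine this.trans ?_
    gcongr
    rw [moment_one]
    exact lintegral_mono fun x => by simp [hf]
  have hlim : Tendsto (fun M : ℕ => moment 1 ν₀ + C / M) atTop (𝓝 (moment 1 ν₀ + 0)) :=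
    tendsto_const_nhds.add (ENNReal.Tendsto.const_div ENNReal.tendsto_nat_nhds_top (Or.inr hC)
      |>.trans (by simp))
  rw [add_zero] at hlim
  refine ge_of_tendsto hlim ?_
  filter_upwards [eventually_ne_atTop 0] with M hM using key M hM

/-! ### Existence of the limit and its fixed-point equation. -/

section Limit

variable {b : ℕ} {μ : ProbabilityMeasure ℝ≥0}

theorem moment_two_lt_top_of_mem_P (hμ : μ ∈ P b) : moment 2 μ < ⊤ :=
  hμ.2.2.trans ENNReal.ofReal_lt_top

theorem var_pos_of_mem_P (hμ : μ ∈ P b) : 0 < var μ := by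
  have h := hμ.2.1
  rw [moment_two_eq hμ.1 (moment_two_lt_top_of_mem_P hμ), ← ENNReal.ofReal_one,
    ENNReal.ofReal_lt_ofReal_iff_of_nonneg zero_le_one] at h
  linarith

theorem var_lt_of_mem_P (hμ : μ ∈ P b) : var μ < b - 2 := by
  have h := hμ.2.2
  rw [moment_two_eq hμ.1 (moment_two_lt_top_of_mem_P hμ), ENNReal.ofReal_lt_ofReal_iff_of_nonneg
    (by linarith [var_pos_of_mem_P hμ])] at h
  linarith

theorem three_le_of_mem_P (hμ : μ ∈ P b) : 3 ≤ b := by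
  have h : (2 : ℝ) < b := by linarith [var_pos_of_mem_P hμ, var_lt_of_mem_P hμ]
  exact_mod_cast h

theorem moment_one_iterate (hb : b ≠ 0) (h1 : moment 1 μ = 1) (k : ℕ) :
    moment 1 ((smoothing b μ)^[k] (diracProba 1)) = 1 := by
  induction k with
  | zero => exact moment_diracProba_one 1
  | succ k ih =>
    rw [Function.iterate_succ_apply']
    exact moment_one_smoothing hb h1 ih

/-- The bound is the fixed point of the increasing affine map `y ↦ ((1 + var μ) y + b - 1) / b`
governing second moments, and the iteration starts at 1, below it. -/
theorem moment_two_iterate_le (hμ : μ ∈ P b) (k : ℕ) :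
    moment 2 ((smoothing b μ)^[k] (diracProba 1)) ≤
      ENNReal.ofReal ((b - 1) / (b - 1 - var μ)) := by
  have h0 := var_pos_of_mem_P hμ
  have hv := var_lt_of_mem_P hμ
  have hb := three_le_of_mem_P hμ
  have hb' : (3 : ℝ) ≤ b := by exact_mod_cast hb
  suffices h : ∃ y : ℝ, 0 ≤ y ∧ y ≤ (b - 1) / (b - 1 - var μ) ∧
      moment 2 ((smoothing b μ)^[k] (diracProba 1)) = ENNReal.ofReal y by
    obtain ⟨y, -, hy, e⟩ := h
    rw [e]
    exact ENNReal.ofReal_le_ofReal hy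
  induction k with
  | zero =>
    refine ⟨1, zero_le_one, ?_, by simpa using moment_diracProba_one 2⟩
    rw [one_le_div (by linarith)]
    linarith
  | succ k ih =>
    obtain ⟨y, hy0, hy, e⟩ := ih
    rw [Function.iterate_succ_apply']
    refine ⟨_, ?_, ?_, moment_two_smoothing_ofReal (by omega) hμ.1
      (moment_one_iterate (by omega) hμ.1 k) (by linarith) hy0
      (moment_two_eq hμ.1 (moment_two_lt_top_of_mem_P hμ)) e⟩
    · have : 0 ≤ (1 + var μ) * y := by positivity
      exact div_nonneg (by linarith) (by linarith)
    · rw [le_div_iff₀ (by linarith)] at hy ⊢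
      rw [div_mul_eq_mul_div, div_le_iff₀ (by linarith)]
      nlinarith

/-- The limit defining `T b μ` exists. -/
theorem tendsto_iterate_smoothing (hμ : μ ∈ P b) :
    Tendsto (fun k : ℕ => (smoothing b μ)^[k] (diracProba 1)) atTop (𝓝 (T b μ)) := by
  have h0 := var_pos_of_mem_P hμ
  have hv := var_lt_of_mem_P hμ
  have hb := three_le_of_mem_P hμ
  have hb' : (3 : ℝ) ≤ b := by exact_mod_cast hb
  have hb0 : b ≠ 0 := by omega
  refine tendsto_nhds_limUnder (exists_tendsto_of_tendsto_cf
    (fun k => (moment_one_iterate hb0 hμ.1 k).le) fun s => ?_)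
  have hm2 (k : ℕ) : moment 2 ((smoothing b μ)^[k] (diracProba 1)) < ⊤ :=
    (moment_two_iterate_le hμ k).trans_lt ENNReal.ofReal_lt_top
  -- Consecutive iterates approach each other geometrically in the distance weighted by `s ^ 2`. The
  -- base case compares `δ₁` with its first image, a law of mean one and finite variance.
  have hstep (k : ℕ) : ∀ s, ‖cf ((smoothing b μ)^[k] (diracProba 1)) s -
      cf ((smoothing b μ)^[k + 1] (diracProba 1)) s‖ ≤
        4 * var (smoothing b μ (diracProba 1)) * ((1 + var μ) / b) ^ k * s ^ 2 := by
    induction k with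
    | zero =>
      intro s
      have := norm_cf_sub_le (moment_one_iterate hb0 hμ.1 1) (hm2 1) s
      simp only [Function.iterate_succ, Function.iterate_zero, Function.comp, id] at this ⊢
      rw [norm_sub_rev, cf_diracProba_one]
      simpa using this
    | succ k ih =>
      intro s
      rw [Function.iterate_succ_apply' _ k, Function.iterate_succ_apply' _ (k + 1), pow_succ,
        ← mul_assoc]
      exact norm_cf_smoothing_sub_le hb0 hμ.1 (moment_two_lt_top_of_mem_P hμ) ih s
  refine cauchySeq_tendsto_of_complete (cauchySeq_of_le_geometric ((1 + var μ) / b)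
    (4 * var (smoothing b μ (diracProba 1)) * s ^ 2) ?_ fun k => ?_)
  · rw [div_lt_one (by linarith)]
    linarith
  · rw [dist_eq_norm]
    refine (hstep k s).trans_eq ?_
    ring

theorem smoothing_T (hμ : μ ∈ P b) : smoothing b μ (T b μ) = T b μ := by
  have h := tendsto_iterate_smoothing hμ
  have h' := ((continuous_smoothing b μ).tendsto (T b μ)).comp h
  refine tendsto_nhds_unique h' ?_
  refine ((tendsto_add_atTop_iff_nat 1).2 h).congr fun k => ?_
  exact Function.iterate_succ_apply' _ _ _

theorem moment_one_T (hμ : μ ∈ P b) : moment 1 (T b μ) = 1 := by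
  have hb0 : b ≠ 0 := by have := three_le_of_mem_P hμ; omega
  have h := tendsto_iterate_smoothing hμ
  refine le_antisymm ?_ (one_le_moment_one_of_tendsto h (moment_one_iterate hb0 hμ.1)
    ENNReal.ofReal_ne_top (moment_two_iterate_le hμ))
  have := lintegral_pow_le_of_tendsto h 1 (C := 1) fun k => by
    simpa [← moment_one] using (moment_one_iterate hb0 hμ.1 k).le
  simpa [← moment_one] using this

theorem moment_two_T_lt_top (hμ : μ ∈ P b) : moment 2 (T b μ) < ⊤ := by
  rw [moment_two]
  refine (lintegral_pow_le_of_tendsto (tendsto_iterate_smoothing hμ) 2 fun k => ?_).trans_lt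
    (ENNReal.ofReal_lt_top (r := (b - 1) / (b - 1 - var μ)))
  rw [← moment_two]
  exact moment_two_iterate_le hμ k

/-- Second moments in `smoothing_T` give `b (1 + v') = (1 + v) (1 + v') + b - 1`. This can be solved
for `v'` because `v'` is already known to be finite. -/
theorem var_T (hμ : μ ∈ P b) : var (T b μ) = var μ / (b - 1 - var μ) := by
  have h0 := var_pos_of_mem_P hμ
  have hv := var_lt_of_mem_P hμ
  have hb := three_le_of_mem_P hμ
  have hb' : (3 : ℝ) ≤ b := by exact_mod_cast hb
  have hT := moment_two_eq (moment_one_T hμ) (moment_two_T_lt_top hμ)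
  have hvT : 0 ≤ var (T b μ) := var_nonneg
  have hb0 : b ≠ 0 := by omega
  have h := moment_two_smoothing_ofReal hb0 hμ.1 (moment_one_T hμ) (by linarith)
    (by linarith) (moment_two_eq hμ.1 (moment_two_lt_top_of_mem_P hμ)) hT
  have hpos : 0 ≤ (1 + var μ) * (1 + var (T b μ)) := by positivity
  rw [smoothing_T hμ, hT, ENNReal.ofReal_eq_ofReal_iff (by linarith)
    (div_nonneg (by linarith) (by linarith)), eq_div_iff (by linarith)] at h
  rw [eq_div_iff (by linarith)]
  linarith

theorem T_mem_P (hμ : μ ∈ P b) : T b μ ∈ P b := by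
  have h0 := var_pos_of_mem_P hμ
  have hv := var_lt_of_mem_P hμ
  have hpos : 0 < var (T b μ) := by
    rw [var_T hμ]
    exact div_pos h0 (by linarith)
  have hlt : var (T b μ) < b - 2 := by
    rw [var_T hμ, div_lt_iff₀ (by linarith)]
    nlinarith
  refine ⟨moment_one_T hμ, ?_, ?_⟩ <;>
    rw [moment_two_eq (moment_one_T hμ) (moment_two_T_lt_top hμ)]
  · rw [← ENNReal.ofReal_one, ENNReal.ofReal_lt_ofReal_iff (by linarith)]
    linarith
  · rw [ENNReal.ofReal_lt_ofReal_iff (by linarith)]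
    linarith

theorem iterate_T_mem_P (hμ : μ ∈ P b) (n : ℕ) : (T b)^[n] μ ∈ P b := by
  induction n with
  | zero => exact hμ
  | succ n ih =>
    rw [Function.iterate_succ_apply']
    exact T_mem_P ih

end Limit

/-! ### Asymptotics of the variance. -/

section Variance

variable {b : ℕ} {μ : ProbabilityMeasure ℝ≥0}

theorem sigma_sq (n : ℕ) : sigma b μ n ^ 2 = var ((T b)^[n] μ) :=
  Real.sq_sqrt var_nonneg

theorem sigma_pos (hμ : μ ∈ P b) (n : ℕ) : 0 < sigma b μ n :=
  Real.sqrt_pos.2 (var_pos_of_mem_P (iterate_T_mem_P hμ n))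

theorem var_iterate_succ (hμ : μ ∈ P b) (n : ℕ) :
    var ((T b)^[n + 1] μ) = var ((T b)^[n] μ) / (b - 1 - var ((T b)^[n] μ)) := by
  rw [Function.iterate_succ_apply', var_T (iterate_T_mem_P hμ n)]

/-- The inverse variance `u` obeys `u' = (b - 1) u - 1`, whose fixed point is `(b - 2)⁻¹`; the
deviation from it is multiplied by `b - 1` at each step. -/
theorem inv_var_iterate (hμ : μ ∈ P b) (n : ℕ) :
    (var ((T b)^[n] μ))⁻¹ = ((b : ℝ) - 1) ^ n * ((var μ)⁻¹ - (b - 2 : ℝ)⁻¹) + (b - 2 : ℝ)⁻¹ := by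
  have hb : (3 : ℝ) ≤ b := by exact_mod_cast three_le_of_mem_P hμ
  have hb2 : (b : ℝ) - 2 ≠ 0 := by linarith
  induction n with
  | zero => simp
  | succ n ih =>
    have h0 := var_pos_of_mem_P (iterate_T_mem_P hμ n)
    have hv := var_lt_of_mem_P (iterate_T_mem_P hμ n)
    have e : (var ((T b)^[n + 1] μ))⁻¹ = (b - 1) * (var ((T b)^[n] μ))⁻¹ - 1 := by
      rw [var_iterate_succ hμ, inv_div, sub_div, div_self h0.ne', div_eq_mul_inv]
    rw [e, ih, pow_succ]
    field_simp
    ring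

theorem tendsto_pow_mul_var (hμ : μ ∈ P b) :
    Tendsto (fun n : ℕ => ((b : ℝ) - 1) ^ n * var ((T b)^[n] μ)) atTop
      (𝓝 ((var μ)⁻¹ - (b - 2 : ℝ)⁻¹)⁻¹) := by
  have hb : (3 : ℝ) ≤ b := by exact_mod_cast three_le_of_mem_P hμ
  have hv := var_lt_of_mem_P hμ
  have h0 := var_pos_of_mem_P hμ
  have hpos : 0 < (var μ)⁻¹ - (b - 2 : ℝ)⁻¹ := sub_pos.2 (inv_strictAnti₀ h0 hv)
  have hlim : Tendsto (fun n : ℕ => ((var μ)⁻¹ - (b - 2 : ℝ)⁻¹) +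
      ((b : ℝ) - 1)⁻¹ ^ n * (b - 2 : ℝ)⁻¹) atTop (𝓝 ((var μ)⁻¹ - (b - 2 : ℝ)⁻¹)) := by
    have := (tendsto_pow_atTop_nhds_zero_of_lt_one (r := ((b : ℝ) - 1)⁻¹)
      (inv_nonneg.2 (by linarith)) (inv_lt_one_of_one_lt₀ (by linarith))).mul_const (b - 2 : ℝ)⁻¹
    simpa using this.const_add ((var μ)⁻¹ - (b - 2 : ℝ)⁻¹)
  refine (hlim.inv₀ hpos.ne').congr fun n => ?_
  have hp : ((b : ℝ) - 1) ^ n ≠ 0 := pow_ne_zero _ (by linarith)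
  rw [← inv_inv (var ((T b)^[n] μ)), inv_var_iterate hμ n, inv_pow]
  rw [← inv_inv (((b : ℝ) - 1) ^ n), ← mul_inv, inv_inv]
  field_simp

theorem tendsto_rpow_mul_sigma (hμ : μ ∈ P b) :
    ∃ c : ℝ, 0 < c ∧
      Tendsto (fun n : ℕ => ((b : ℝ) - 1) ^ ((n : ℝ) / 2) * sigma b μ n) atTop (𝓝 c) := by
  have hb : (3 : ℝ) ≤ b := by exact_mod_cast three_le_of_mem_P hμ
  have hpos : 0 < (var μ)⁻¹ - (b - 2 : ℝ)⁻¹ :=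
    sub_pos.2 (inv_strictAnti₀ (var_pos_of_mem_P hμ) (var_lt_of_mem_P hμ))
  refine ⟨√((var μ)⁻¹ - (b - 2 : ℝ)⁻¹)⁻¹, Real.sqrt_pos.2 (inv_pos.2 hpos), ?_⟩
  refine ((Real.continuous_sqrt.tendsto _).comp (tendsto_pow_mul_var hμ)).congr fun n => ?_
  have hb1 : (0 : ℝ) ≤ b - 1 := by linarith
  rw [Function.comp_apply, Real.sqrt_mul (by positivity), Real.sqrt_eq_rpow,
    ← Real.rpow_natCast, ← Real.rpow_mul hb1, mul_one_div]
  rfl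

theorem tendsto_var (hμ : μ ∈ P b) :
    Tendsto (fun n : ℕ => var ((T b)^[n] μ)) atTop (𝓝 0) := by
  have hb : (3 : ℝ) ≤ b := by exact_mod_cast three_le_of_mem_P hμ
  have h := (tendsto_pow_atTop_nhds_zero_of_lt_one (r := ((b : ℝ) - 1)⁻¹)
    (inv_nonneg.2 (by linarith)) (inv_lt_one_of_one_lt₀ (by linarith))).mul
    (tendsto_pow_mul_var hμ)
  rw [zero_mul] at h
  refine h.congr fun n => ?_
  rw [← mul_assoc, ← mul_pow, inv_mul_cancel₀ (by linarith), one_pow, one_mul]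

theorem tendsto_sigma (hμ : μ ∈ P b) : Tendsto (sigma b μ) atTop (𝓝 0) := by
  have h := (Real.continuous_sqrt.tendsto _).comp (tendsto_var hμ)
  rw [Real.sqrt_zero] at h
  exact h

theorem tendsto_iterate_T (hμ : μ ∈ P b) :
    Tendsto (fun n : ℕ => (T b)^[n] μ) atTop (𝓝 (diracProba 1)) := by
  have hcf (s : ℝ) : Tendsto (fun n : ℕ => cf ((T b)^[n] μ) s) atTop
      (𝓝 (cf (diracProba 1) s)) := by
    rw [tendsto_iff_norm_sub_tendsto_zero, cf_diracProba_one]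
    refine squeeze_zero (fun n => norm_nonneg _) (fun n => norm_cf_sub_le
      (iterate_T_mem_P hμ n).1 (moment_two_lt_top_of_mem_P (iterate_T_mem_P hμ n)) s) ?_
    simpa using ((tendsto_var hμ).const_mul 4).mul_const (s ^ 2)
  obtain ⟨ν, hν⟩ := exists_tendsto_of_tendsto_cf (fun n => (iterate_T_mem_P hμ n).1.le)
    fun s => ⟨_, hcf s⟩
  rwa [← ext_of_cf fun s => tendsto_nhds_unique (tendsto_cf hν s) (hcf s)]

end Variance

/-! ### Recursion for the third moment. -/

section ThirdMoment

variable {b : ℕ} {μ : ProbabilityMeasure ℝ≥0}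

theorem moment_three_smoothing_le (hb : 2 ≤ b) {μ ν : ProbabilityMeasure ℝ≥0}
    (hμ : moment 1 μ = 1) (hν : moment 1 ν = 1) {m z t y : ℝ} (hm : 0 ≤ m) (hz : 0 ≤ z)
    (ht : 0 ≤ t) (hy : 0 ≤ y) (hμ3 : moment 3 μ ≤ ENNReal.ofReal m)
    (hν3 : moment 3 ν ≤ ENNReal.ofReal z) (hμ2 : moment 2 μ ≤ ENNReal.ofReal t)
    (hν2 : moment 2 ν ≤ ENNReal.ofReal y) :
    moment 3 (smoothing b μ ν) ≤
      ENNReal.ofReal ((m * z + 3 * (b - 1) * (t * y) + (b - 1) * (b - 2)) / b ^ 2) := by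
  have hb2 : (2 : ℝ) ≤ b := by exact_mod_cast hb
  have hb' : (0 : ℝ) < b := by linarith
  have e1 : ((b * (b - 1) : ℕ) : ℝ≥0∞) = ENNReal.ofReal (b * (b - 1)) := by
    rw [← ENNReal.ofReal_natCast]
    push_cast [show 1 ≤ b by omega]
    rfl
  have e3 : ((b * (b - 1) * (b - 2) : ℕ) : ℝ≥0∞) = ENNReal.ofReal (b * (b - 1) * (b - 2)) := by
    rw [← ENNReal.ofReal_natCast]
    push_cast [show 1 ≤ b by omega, hb]
    rfl
  have e2 : (b : ℝ≥0∞)⁻¹ = ENNReal.ofReal ((b : ℝ)⁻¹) := by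
    rw [ENNReal.ofReal_inv_of_pos hb', ENNReal.ofReal_natCast]
  have p1 : 0 ≤ (b : ℝ) * (b - 1) := mul_nonneg hb'.le (by linarith)
  have p2 : 0 ≤ (b : ℝ) * (b - 1) * (b - 2) := mul_nonneg p1 (by linarith)
  calc moment 3 (smoothing b μ ν)
      ≤ (b : ℝ≥0∞)⁻¹ ^ 3 * (b * (ENNReal.ofReal m * ENNReal.ofReal z) +
        3 * (b * (b - 1) : ℕ) * (ENNReal.ofReal t * ENNReal.ofReal y) +
          (b * (b - 1) * (b - 2) : ℕ)) := by
        rw [moment_three_smoothing (by omega) hμ hν]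
        gcongr
    _ = _ := by
        rw [e1, e2, e3, ← ENNReal.ofReal_natCast b, ← ENNReal.ofReal_mul hm,
          ← ENNReal.ofReal_mul ht, ← ENNReal.ofReal_mul hb'.le,
          show (3 : ℝ≥0∞) = ENNReal.ofReal 3 by simp, ← ENNReal.ofReal_mul (by norm_num),
          ← ENNReal.ofReal_mul (by positivity), ← ENNReal.ofReal_add (by positivity)
            (by positivity), ← ENNReal.ofReal_add (by positivity) p2,
          ← ENNReal.ofReal_pow (by positivity), ← ENNReal.ofReal_mul (by positivity)]
        congr 1
        field_simp

theorem one_le_moment_three (h1 : moment 1 μ = 1) : 1 ≤ moment 3 μ := by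
  have h : ∫⁻ x : ℝ≥0, 3 * (x : ℝ≥0∞) ∂(μ : Measure ℝ≥0) ≤
      ∫⁻ x : ℝ≥0, ((x : ℝ≥0∞) ^ 3 + 2) ∂(μ : Measure ℝ≥0) := by
    refine lintegral_mono fun x => ?_
    have : 3 * x ≤ x ^ 3 + 2 := by
      rw [← NNReal.coe_le_coe]
      push_cast
      nlinarith [mul_nonneg (sq_nonneg ((x : ℝ) - 1)) (add_nonneg x.coe_nonneg zero_le_two)]
    dsimp only
    exact_mod_cast this
  rw [lintegral_const_mul _ (by fun_prop), ← moment_one, h1, lintegral_add_right _ (by fun_prop),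
    ← moment_three] at h
  simp only [mul_one, lintegral_const, measure_univ] at h
  rw [show (3 : ℝ≥0∞) = 1 + 2 by norm_num] at h
  exact (ENNReal.add_le_add_iff_right (by simp)).1 h

/-- The constant in the recursion `m₃ (T b μ) ≤ thirdConst b t / (b ^ 2 - m₃ μ)`, where `t` is the
second moment of `μ`. -/
noncomputable def thirdConst (b t : ℝ) : ℝ :=
  3 * (b - 1) ^ 2 * t / (b - t) + (b - 1) * (b - 2)

theorem thirdConst_mono {b s t : ℝ} (hs : 0 ≤ s) (hst : s ≤ t) (ht : t < b) :
    thirdConst b s ≤ thirdConst b t := by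
  unfold thirdConst
  have : 0 ≤ t := hs.trans hst
  have : 0 < b - t := by linarith
  gcongr

/-- The bound `Z` is the fixed point of `z ↦ (m z + C) / b ^ 2`, where `C` is `thirdConst`. It
dominates the starting value 1, hence every iterate of `smoothing b μ` from `δ₁`, and it survives
the weak limit. -/
theorem moment_three_T_le (hμ : μ ∈ P b) {m : ℝ} (hm : m < b ^ 2)
    (hμ3 : moment 3 μ ≤ ENNReal.ofReal m) :
    moment 3 (T b μ) ≤ ENNReal.ofReal (thirdConst b (1 + var μ) / (b ^ 2 - m)) := by
  have h0 := var_pos_of_mem_P hμ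
  have hv := var_lt_of_mem_P hμ
  have hb := three_le_of_mem_P hμ
  have hb' : (3 : ℝ) ≤ b := by exact_mod_cast hb
  have hm1 : 1 ≤ m := by
    have := (one_le_moment_three hμ.1).trans hμ3
    rwa [← ENNReal.ofReal_one, ENNReal.ofReal_le_ofReal_iff' , or_iff_left (by norm_num)] at this
  set Y : ℝ := (b - 1) / (b - 1 - var μ) with hY
  have hY1 : 1 ≤ Y := by rw [hY, one_le_div (by linarith)]; linarith
  have hC : thirdConst b (1 + var μ) = 3 * (b - 1) * ((1 + var μ) * Y) + (b - 1) * (b - 2) := by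
    have : (b : ℝ) - 1 - var μ ≠ 0 := by linarith
    rw [thirdConst, hY, show (b : ℝ) - (1 + var μ) = b - 1 - var μ by ring]
    field_simp
  -- Because `3 (b - 1) + (b - 1) (b - 2) = b ^ 2 - 1`, the inequality `m ≥ 1` suffices.
  have hC1 : (b : ℝ) ^ 2 - m ≤ thirdConst b (1 + var μ) := by
    rw [hC]
    have : 1 ≤ (1 + var μ) * Y := by nlinarith
    nlinarith
  set Z : ℝ := thirdConst b (1 + var μ) / (b ^ 2 - m) with hZ
  have hZ1 : 1 ≤ Z := by rwa [hZ, one_le_div (by linarith)]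
  have hit (k : ℕ) : moment 3 ((smoothing b μ)^[k] (diracProba 1)) ≤ ENNReal.ofReal Z := by
    induction k with
    | zero => simpa [moment_diracProba_one] using hZ1
    | succ k ih =>
      rw [Function.iterate_succ_apply']
      refine (moment_three_smoothing_le (by omega) hμ.1 (moment_one_iterate (by omega) hμ.1 k)
        (by linarith) (by linarith) (by linarith) (by linarith) hμ3 ih
        (moment_two_eq hμ.1 (moment_two_lt_top_of_mem_P hμ)).le
        (moment_two_iterate_le hμ k)).trans_eq ?_
      congr 1
      have hbm : (b : ℝ) ^ 2 - m ≠ 0 := by linarith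
      have hZm : Z * (b ^ 2 - m) = thirdConst b (1 + var μ) := div_mul_cancel₀ _ hbm
      rw [div_eq_iff (by positivity), add_assoc, ← hC, ← hZm]
      ring
  rw [moment_three]
  refine lintegral_pow_le_of_tendsto (tendsto_iterate_smoothing hμ) 3 fun k => ?_
  rw [← moment_three]
  exact hit k

/-- The map `x ↦ (B ^ 2 - d ^ 2) / (2 B - x)` is increasing below `2 B` with fixed points `B ± d`,
the upper one repelling. Orbits starting strictly below `B + d` stay there, and `x ≤ B` is preserved
once reached. -/
theorem lt_and_eventually_le_of_recursion {B d : ℝ} (hd : 0 < d) (hdB : d < B) {m : ℕ → ℝ}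
    (h0 : m 0 < B + d) (hm : ∀ n, m n < B + d → m (n + 1) ≤ (B ^ 2 - d ^ 2) / (2 * B - m n)) :
    (∀ n, m n < B + d) ∧ ∀ᶠ n in atTop, m n ≤ B := by
  have hlt (n : ℕ) : m n < B + d := by
    induction n with
    | zero => exact h0
    | succ n ih =>
      refine (hm n ih).trans_lt ?_
      rw [div_lt_iff₀ (by linarith)]
      nlinarith
  have hstay (n : ℕ) (hn : m n ≤ B) : m (n + 1) ≤ B := by
    refine (hm n (hlt n)).trans ?_
    rw [div_le_iff₀ (by linarith)]
    nlinarith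
  refine ⟨hlt, ?_⟩
  obtain ⟨N, hN⟩ : ∃ N, m N ≤ B := by
    by_contra! hcon
    set x := m 0 - B with hx
    have hx0 : 0 < x := by linarith [hcon 0]
    have hxd : x < d := by linarith
    -- While `m n` lies between `B` and `B + x`, each step decreases it by at least `δ`: with `y = m
    -- n - B` one needs `δ (B - y) ≤ d ^ 2 - y ^ 2`, and here `0 ≤ y ≤ x`.
    set δ := (d ^ 2 - x ^ 2) / B with hδ
    have hδ0 : 0 < δ := div_pos (by nlinarith) (by linarith)
    have hδB : δ * B = d ^ 2 - x ^ 2 := div_mul_cancel₀ _ (by linarith)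
    have hdrop (n : ℕ) : m n - B ≤ x - n * δ := by
      induction n with
      | zero => simp [hx]
      | succ n ih =>
        have hn := hcon n
        have hn' := hlt n
        have hxn : m n - B ≤ x := ih.trans (by have : 0 ≤ n * δ := by positivity
                                               linarith)
        have key : m (n + 1) ≤ m n - δ := by
          refine (hm n hn').trans ?_
          rw [div_le_iff₀ (by linarith)]
          have h1 : δ * (2 * B - m n) ≤ δ * B := by gcongr; linarith
          have h2 : (m n - B) ^ 2 ≤ x ^ 2 := by
            have : 0 ≤ m n - B := by linarith
            gcongr
          nlinarith
        push_cast
        linarith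
    obtain ⟨n, hn⟩ := exists_nat_gt (x / δ)
    rw [div_lt_iff₀ hδ0] at hn
    linarith [hdrop n, hcon n]
  filter_upwards [eventually_ge_atTop N] with n hn
  induction n, hn using Nat.le_induction with
  | base => exact hN
  | succ n _ ih => exact hstay n ih

theorem D_subset_P : D b ⊆ P b := fun _ h =>
  ⟨h.1, h.2.1, h.2.2.1.trans_le (ENNReal.ofReal_le_ofReal (min_le_left _ _))⟩

theorem var_iterate_succ_le (hμ : μ ∈ P b) (n : ℕ) :
    var ((T b)^[n + 1] μ) ≤ var ((T b)^[n] μ) := by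
  have h0 := var_pos_of_mem_P (iterate_T_mem_P hμ n)
  have hv := var_lt_of_mem_P (iterate_T_mem_P hμ n)
  rw [var_iterate_succ hμ, div_le_iff₀ (by linarith)]
  nlinarith

theorem var_iterate_le (hμ : μ ∈ P b) (n : ℕ) : var ((T b)^[n] μ) ≤ var μ :=
  antitone_nat_of_succ_le (f := fun n => var ((T b)^[n] μ)) (var_iterate_succ_le hμ)
    (Nat.zero_le n)

/-- Third moments along the iteration of `T b` from `𝒟_b` are finite, less than `b ^ 2`, and
eventually at most `b ^ 2 / 2`. -/
theorem exists_third_moment_bound (hμ : μ ∈ D b) :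
    ∃ m : ℕ → ℝ, (∀ n, m n < b ^ 2 ∧ moment 3 ((T b)^[n] μ) ≤ ENNReal.ofReal (m n)) ∧
      ∀ᶠ n in atTop, m n ≤ b ^ 2 / 2 := by
  have hP := D_subset_P hμ
  have h0 := var_pos_of_mem_P hP
  have hv := var_lt_of_mem_P hP
  have hb := three_le_of_mem_P hP
  have hb' : (3 : ℝ) ≤ b := by exact_mod_cast hb
  obtain ⟨-, -, hw2, hw3⟩ := hμ
  rw [toReal_moment_two hP.1 (moment_two_lt_top_of_mem_P hP)] at hw3
  rw [moment_two_eq hP.1 (moment_two_lt_top_of_mem_P hP),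
    ENNReal.ofReal_lt_ofReal_iff_of_nonneg (by linarith)] at hw2
  set t := 1 + var μ with ht
  have hq : (0 : ℝ) < (b : ℝ) ^ 4 + 8 * b ^ 2 - 12 * b + 4 := by
    nlinarith [pow_pos (show (0 : ℝ) < b by linarith) 4]
  have hw2' := hw2.trans_le (min_le_right _ _)
  rw [← mul_div_assoc, lt_div_iff₀ hq] at hw2'
  set disc : ℝ := ((b : ℝ) * (b ^ 4 - 4 * b ^ 2 + 12 * b - 8)
    - t * (b ^ 4 + 8 * b ^ 2 - 12 * b + 4)) / (b - t) with hdisc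
  have hbt : 0 < (b : ℝ) - t := by linarith
  have hdpos : 0 < disc := div_pos (by linarith) hbt
  -- This says that `b ^ 2 / 2 ± d`, with `d` half the square root of `disc`, are the roots of `x (b
  -- ^ 2 - x) = thirdConst b t`. The larger root is `w₃ b t`, and the second entry of the minimum in
  -- `w₂` is what makes `disc` positive.
  have hCd : thirdConst b t = ((b : ℝ) ^ 2 / 2) ^ 2 - (1 / 2 * √disc) ^ 2 := by
    rw [mul_pow, Real.sq_sqrt hdpos.le, thirdConst, hdisc]
    field_simp
    ring
  have hCpos : 0 < thirdConst b t := by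
    have h1 : 0 ≤ 3 * ((b : ℝ) - 1) ^ 2 * t / (b - t) := by positivity
    have h2 : 0 < ((b : ℝ) - 1) * (b - 2) := mul_pos (by linarith) (by linarith)
    unfold thirdConst
    linarith
  set d := 1 / 2 * √disc with hd
  have hd0 : 0 < d := by positivity
  have hdB : d < (b : ℝ) ^ 2 / 2 := by
    refine lt_of_pow_lt_pow_left₀ 2 (by positivity) (by linarith)
  have hfin (n : ℕ) {m : ℝ} (hm : m < b ^ 2 / 2 + d)
      (h3 : moment 3 ((T b)^[n] μ) ≤ ENNReal.ofReal m) :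
      moment 3 ((T b)^[n + 1] μ) ≤
        ENNReal.ofReal (((b ^ 2 / 2) ^ 2 - d ^ 2) / (2 * (b ^ 2 / 2) - m)) := by
    rw [Function.iterate_succ_apply']
    refine (moment_three_T_le (iterate_T_mem_P hP n) (by linarith) h3).trans
      (ENNReal.ofReal_le_ofReal ?_)
    rw [← hCd, show 2 * ((b : ℝ) ^ 2 / 2) = b ^ 2 by ring]
    have hpos : 0 < (b : ℝ) ^ 2 - m := by linarith
    gcongr
    -- Variances do not increase along the iteration, so the constant computed from the initial
    -- second moment serves at every step.
    have := var_iterate_le hP n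
    exact thirdConst_mono (by linarith [var_nonneg (ν := (T b)^[n] μ)])
      (by linarith) (by linarith)
  let m : ℕ → ℝ := fun n => Nat.rec (moment 3 μ).toReal
    (fun _ x => ((b ^ 2 / 2) ^ 2 - d ^ 2) / (2 * (b ^ 2 / 2) - x)) n
  have hm0 : m 0 < b ^ 2 / 2 + d := by
    have : 0 < w₃ b t := by
      unfold w₃
      positivity
    have h := (ENNReal.toReal_lt_toReal hw3.ne_top ENNReal.ofReal_ne_top).2 hw3
    rwa [ENNReal.toReal_ofReal this.le] at h
  obtain ⟨hlt, hev⟩ := lt_and_eventually_le_of_recursion hd0 hdB hm0 fun n _ => le_rfl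
  refine ⟨m, fun n => ⟨by linarith [hlt n], ?_⟩, hev⟩
  induction n with
  | zero => exact (ENNReal.ofReal_toReal hw3.ne_top).ge
  | succ n ih => exact hfin n (hlt n) ih

end ThirdMoment

/-! ### Third absolute moments of centred sums and products. -/

/-- The term linear in `z` has as coefficient the derivative of `|x| ^ 3`, so it disappears when a
centred `z` is integrated out. -/
theorem abs_add_pow_three_le (x z : ℝ) :
    |x + z| ^ 3 ≤ |x| ^ 3 + 3 * (x * |x|) * z + 3 * |x| * z ^ 2 + |z| ^ 3 := by
  have key (x z : ℝ) (hx : 0 ≤ x) :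
      |x + z| ^ 3 ≤ |x| ^ 3 + 3 * (x * |x|) * z + 3 * |x| * z ^ 2 + |z| ^ 3 := by
    rw [abs_of_nonneg hx]
    rcases le_total 0 (x + z) with h | h
    · rw [abs_of_nonneg h]
      nlinarith [pow_le_pow_left₀ (abs_nonneg z) le_rfl 3, le_abs_self (z ^ 3), abs_pow z 3]
    · rw [abs_of_nonpos h, abs_of_nonpos (by linarith : z ≤ 0)]
      -- The two sides differ by `2 x (x ^ 2 + 3 x z + 3 z ^ 2)`, whose quadratic factor is positive
      -- semidefinite.
      nlinarith [mul_nonneg hx (by nlinarith [sq_nonneg (x + 3 / 2 * z), sq_nonneg z] :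
        0 ≤ x ^ 2 + 3 * x * z + 3 * z ^ 2)]
  rcases le_total 0 x with h | h
  · exact key x z h
  · have := key (-x) (-z) (by linarith)
    rw [← neg_add, abs_neg, abs_neg, abs_neg] at this
    linarith

theorem integrable_abs_pow_three {α : Type*} [MeasurableSpace α] {ρ : Measure α} {Z : α → ℝ}
    [IsFiniteMeasure ρ] (h3 : MemLp Z 3 ρ) : Integrable (fun a => |Z a| ^ 3) ρ := by
  simpa using h3.integrable_norm_pow (p := 3) (by norm_num)

section IndependentSums

variable {α : Type*} [MeasurableSpace α] {ρ : Measure α} [IsProbabilityMeasure ρ] {Z : α → ℝ}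

theorem integral_abs_add_pow_three_le (h3 : MemLp Z 3 ρ) (h0 : ∫ a, Z a ∂ρ = 0) (y : ℝ) :
    Integrable (fun a => |y + Z a| ^ 3) ρ ∧
    ∫ a, |y + Z a| ^ 3 ∂ρ ≤ |y| ^ 3 + 3 * |y| * ∫ a, Z a ^ 2 ∂ρ + ∫ a, |Z a| ^ 3 ∂ρ := by
  have i1 : Integrable Z ρ := h3.integrable (by norm_num)
  have i2 : Integrable (fun a => Z a ^ 2) ρ := (h3.mono_exponent (by norm_num)).integrable_sq
  have i3 := integrable_abs_pow_three h3
  have hi : Integrable (fun a => |y + Z a| ^ 3) ρ :=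
    integrable_abs_pow_three ((memLp_const y).add h3)
  have j1 : Integrable (fun a => |y| ^ 3 + 3 * (y * |y|) * Z a) ρ :=
    (integrable_const _).add (i1.const_mul _)
  have j2 : Integrable (fun a => |y| ^ 3 + 3 * (y * |y|) * Z a + 3 * |y| * Z a ^ 2) ρ :=
    j1.add (i2.const_mul _)
  refine ⟨hi, (integral_mono hi (j2.add i3) fun a => abs_add_pow_three_le y (Z a)).trans_eq ?_⟩
  simp only [Pi.add_apply]
  rw [integral_add j2 i3, integral_add j1 (i2.const_mul _),
    integral_add (integrable_const _) (i1.const_mul _), integral_const_mul, integral_const_mul, h0]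
  simp

theorem lintegral_abs_add_pow_three_le (h3 : MemLp Z 3 ρ) (h0 : ∫ a, Z a ∂ρ = 0) (y : ℝ) :
    ∫⁻ a, ENNReal.ofReal (|y + Z a| ^ 3) ∂ρ ≤
      ENNReal.ofReal (|y| ^ 3 + 3 * |y| * ∫ a, Z a ^ 2 ∂ρ + ∫ a, |Z a| ^ 3 ∂ρ) := by
  obtain ⟨hi, hle⟩ := integral_abs_add_pow_three_le h3 h0 y
  rw [← ofReal_integral_eq_lintegral_ofReal hi (ae_of_all _ fun a => by positivity)]
  exact ENNReal.ofReal_le_ofReal hle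

theorem integral_abs_le_of_integral_sq_eq (h2 : MemLp Z 2 ρ) {s : ℝ} (hs : 0 ≤ s)
    (hZ : ∫ a, Z a ^ 2 ∂ρ = s ^ 2) : ∫ a, |Z a| ∂ρ ≤ s := by
  have h := variance_eq_sub h2.abs
  have h' := variance_nonneg (fun a => |Z a|) ρ
  rw [show Var[fun a => |Z a|; ρ] = _ from h] at h'
  simp only [Pi.pow_apply, Pi.abs_apply, sq_abs, hZ] at h'
  exact le_of_sq_le_sq (by linarith) hs

/-- The triangle inequality loses a factor `√n` against orthogonality, which is immaterial since it
is applied with a fixed number of summands. -/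
theorem lintegral_abs_sum_le (hZ : Measurable Z) (h3 : MemLp Z 3 ρ) {s : ℝ} (hs : 0 ≤ s)
    (h2 : ∫ a, Z a ^ 2 ∂ρ = s ^ 2) (n : ℕ) :
    ∫⁻ z, ENNReal.ofReal |∑ j, Z (z j)| ∂(Measure.pi fun _ : Fin n => ρ) ≤
      ENNReal.ofReal (n * s) := by
  have i1 : Integrable Z ρ := h3.integrable (by norm_num)
  have h1 : ∫⁻ a, ENNReal.ofReal |Z a| ∂ρ ≤ ENNReal.ofReal s := by
    rw [← ofReal_integral_eq_lintegral_ofReal i1.abs (ae_of_all _ fun a => abs_nonneg _)]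
    exact ENNReal.ofReal_le_ofReal
      (integral_abs_le_of_integral_sq_eq (h3.mono_exponent (by norm_num)) hs h2)
  calc _ ≤ ∫⁻ z, ∑ j, ENNReal.ofReal |Z (z j)| ∂(Measure.pi fun _ : Fin n => ρ) := by
        refine lintegral_mono fun z => ?_
        rw [← ENNReal.ofReal_sum_of_nonneg fun _ _ => abs_nonneg _]
        exact ENNReal.ofReal_le_ofReal (Finset.abs_sum_le_sum_abs _ _)
    _ = ∑ j : Fin n, ∫⁻ a, ENNReal.ofReal |Z a| ∂ρ := by
        rw [lintegral_finsetSum _ fun j _ => by fun_prop]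
        refine Finset.sum_congr rfl fun j _ => ?_
        exact (measurePreserving_eval (fun _ : Fin n => ρ) j).lintegral_comp
          (f := fun a => ENNReal.ofReal |Z a|) (by fun_prop)
    _ ≤ ∑ _j : Fin n, ENNReal.ofReal s := Finset.sum_le_sum fun _ _ => h1
    _ = _ := by
        rw [Finset.sum_const, Finset.card_fin, nsmul_eq_mul, ENNReal.ofReal_mul (by positivity),
          ENNReal.ofReal_natCast]

theorem lintegral_pi_succ_sum (hZ : Measurable Z) {f : ℝ → ℝ≥0∞} (hf : Measurable f) (n : ℕ) :
    ∫⁻ z, f (∑ j, Z (z j)) ∂(Measure.pi fun _ : Fin (n + 1) => ρ) =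
      ∫⁻ z, ∫⁻ a, f (∑ j, Z (z j) + Z a) ∂ρ ∂(Measure.pi fun _ : Fin n => ρ) := by
  have h := measurePreserving_piFinSuccAbove (fun _ : Fin (n + 1) => ρ) 0
  have key : ∫⁻ z, f (∑ j, Z (z j)) ∂(Measure.pi fun _ : Fin (n + 1) => ρ) =
      ∫⁻ p : α × (Fin n → α), f (∑ j, Z (p.2 j) + Z p.1)
        ∂(ρ.prod (Measure.pi fun _ : Fin n => ρ)) := by
    rw [← h.lintegral_comp (by fun_prop)]
    refine lintegral_congr fun z => ?_
    simp [Fin.sum_univ_succ, Fin.tail, add_comm]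
  rw [key, lintegral_prod_symm _ (by fun_prop)]

/-- A Rosenthal-type bound for third absolute moments of sums of independent centred variables. -/
theorem lintegral_abs_sum_pow_three_le (hZ : Measurable Z) (h3 : MemLp Z 3 ρ)
    (h0 : ∫ a, Z a ∂ρ = 0) {s c : ℝ} (hs : 0 ≤ s) (h2 : ∫ a, Z a ^ 2 ∂ρ = s ^ 2)
    (hc : ∫ a, |Z a| ^ 3 ∂ρ ≤ c) (n : ℕ) :
    ∫⁻ z, ENNReal.ofReal (|∑ j, Z (z j)| ^ 3) ∂(Measure.pi fun _ : Fin n => ρ) ≤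
      ENNReal.ofReal (n * c + 3 * n ^ 2 * s ^ 3) := by
  have hc0 : 0 ≤ c := by
    refine le_trans ?_ hc
    exact integral_nonneg fun a => pow_nonneg (abs_nonneg _) 3
  have hs3 : 0 ≤ s ^ 3 := by positivity
  induction n with
  | zero => simp
  | succ n ih =>
    have hns3 : 0 ≤ (n : ℝ) * s ^ 3 := by positivity
    rw [lintegral_pi_succ_sum hZ (f := fun x => ENNReal.ofReal (|x| ^ 3)) (by fun_prop)]
    -- Here `y` stands for the sum of the first `n` variables; its mean absolute value is at most `n
    -- s`, so adding one variable costs at most `c + 3 n s ^ 3`.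
    have step (y : ℝ) : ∫⁻ a, ENNReal.ofReal (|y + Z a| ^ 3) ∂ρ ≤ ENNReal.ofReal (|y| ^ 3) +
        ENNReal.ofReal (3 * s ^ 2) * ENNReal.ofReal |y| + ENNReal.ofReal c := by
      rw [← ENNReal.ofReal_mul (by positivity), ← ENNReal.ofReal_add (by positivity)
        (by positivity), ← ENNReal.ofReal_add (by positivity) hc0]
      refine (lintegral_abs_add_pow_three_le h3 h0 _).trans (ENNReal.ofReal_le_ofReal ?_)
      rw [h2]
      linarith
    refine le_trans (lintegral_mono (g := fun z : Fin n → α =>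
      ENNReal.ofReal (|∑ j, Z (z j)| ^ 3) +
        ENNReal.ofReal (3 * s ^ 2) * ENNReal.ofReal |∑ j, Z (z j)| + ENNReal.ofReal c) ?_) ?_
    · intro z
      exact step _
    have m1 : Measurable fun z : Fin n → α => ENNReal.ofReal |∑ j, Z (z j)| := by fun_prop
    have m3 : Measurable fun z : Fin n → α => ENNReal.ofReal (|∑ j, Z (z j)| ^ 3) := by fun_prop
    rw [lintegral_add_right _ measurable_const, lintegral_add_left m3, lintegral_const_mul _ m1,
      lintegral_const, measure_univ, mul_one]
    refine (add_le_add_left (add_le_add ih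
      (mul_le_mul_right (lintegral_abs_sum_le hZ h3 hs h2 n) _)) _).trans ?_
    have hp : 0 ≤ (n : ℝ) * c + 3 * n ^ 2 * s ^ 3 := by positivity
    have hp' : 0 ≤ 3 * s ^ 2 * (n * s) := by positivity
    rw [← ENNReal.ofReal_mul (by positivity), ← ENNReal.ofReal_add hp hp',
      ← ENNReal.ofReal_add (add_nonneg hp hp') hc0]
    refine ENNReal.ofReal_le_ofReal ?_
    push_cast
    nlinarith

end IndependentSums

/-- `mulLaw` as a probability measure. -/
noncomputable def mulProb (μ ν : ProbabilityMeasure ℝ≥0) : ProbabilityMeasure ℝ≥0 :=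
  ⟨mulLaw (μ : Measure ℝ≥0) ν, inferInstance⟩

theorem coe_mulProb (μ ν : ProbabilityMeasure ℝ≥0) :
    (mulProb μ ν : Measure ℝ≥0) = mulLaw (μ : Measure ℝ≥0) ν := rfl

theorem moment_one_mulProb {μ ν : ProbabilityMeasure ℝ≥0} (hμ : moment 1 μ = 1)
    (hν : moment 1 ν = 1) : moment 1 (mulProb μ ν) = 1 := by
  rw [moment_one, coe_mulProb, lintegral_mulLaw_id hμ hν]

theorem moment_two_mulProb (μ ν : ProbabilityMeasure ℝ≥0) :
    moment 2 (mulProb μ ν) = moment 2 μ * moment 2 ν := by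
  rw [moment_two, coe_mulProb, lintegral_mulLaw_pow, moment_two, moment_two]

theorem moment_three_mulProb (μ ν : ProbabilityMeasure ℝ≥0) :
    moment 3 (mulProb μ ν) = moment 3 μ * moment 3 ν := by
  rw [moment_three, coe_mulProb, lintegral_mulLaw_pow, moment_three, moment_three]

theorem moment_two_mulProb_lt_top {μ ν : ProbabilityMeasure ℝ≥0} (hμ : moment 2 μ < ⊤)
    (hν : moment 2 ν < ⊤) : moment 2 (mulProb μ ν) < ⊤ := by
  rw [moment_two_mulProb]
  exact ENNReal.mul_lt_top hμ hν

theorem one_add_var_mulProb {μ ν : ProbabilityMeasure ℝ≥0} (hμ : moment 1 μ = 1)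
    (hν : moment 1 ν = 1) (hμ2 : moment 2 μ < ⊤) (hν2 : moment 2 ν < ⊤) :
    1 + var (mulProb μ ν) = (1 + var μ) * (1 + var ν) := by
  rw [← toReal_moment_two hμ hμ2, ← toReal_moment_two hν hν2, ← ENNReal.toReal_mul,
    ← moment_two_mulProb, toReal_moment_two (moment_one_mulProb hμ hν)
      (moment_two_mulProb_lt_top hμ2 hν2)]

/-- The third absolute central moment of a law with mean one. -/
noncomputable def absThird (ν : ProbabilityMeasure ℝ≥0) : ℝ :=
  ∫ x : ℝ≥0, |(x : ℝ) - 1| ^ 3 ∂(ν : Measure ℝ≥0)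

section Bounds

variable {μ ν : ProbabilityMeasure ℝ≥0}

theorem absThird_nonneg : 0 ≤ absThird ν := integral_nonneg fun _ => by positivity

theorem memLp_three (h3 : moment 3 ν < ⊤) :
    MemLp (fun x : ℝ≥0 => (x : ℝ)) 3 (ν : Measure ℝ≥0) := by
  simpa using memLp_coe (k := 3) (by norm_num) (by rwa [← moment_three])

theorem memLp_sub_one_three (h3 : moment 3 ν < ⊤) :
    MemLp (fun x : ℝ≥0 => (x : ℝ) - 1) 3 (ν : Measure ℝ≥0) :=
  (memLp_three h3).sub (memLp_const 1)

theorem moment_two_lt_top_of_three (h3 : moment 3 ν < ⊤) : moment 2 ν < ⊤ := by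
  have h := (memLp_three h3).mono_exponent (p := 2) (by norm_num)
  have := (eLpNorm_lt_top_iff_lintegral_rpow_enorm_lt_top (by norm_num) (by norm_num)).1 h.2
  rw [moment_two]
  simpa using this

theorem lintegral_abs_sub_one_pow_three (h3 : moment 3 ν < ⊤) :
    ∫⁻ x : ℝ≥0, ENNReal.ofReal (|(x : ℝ) - 1| ^ 3) ∂(ν : Measure ℝ≥0) =
      ENNReal.ofReal (absThird ν) := by
  rw [absThird, ofReal_integral_eq_lintegral_ofReal
    (integrable_abs_pow_three (memLp_sub_one_three h3)) (ae_of_all _ fun a => by positivity)]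

theorem integral_abs_sub_one_le (h2 : moment 2 ν < ⊤) :
    ∫ x : ℝ≥0, |(x : ℝ) - 1| ∂(ν : Measure ℝ≥0) ≤ √(var ν) :=
  integral_abs_le_of_integral_sq_eq (memLp_sub_one_two h2) (Real.sqrt_nonneg _)
    (by rw [Real.sq_sqrt var_nonneg, var])

theorem absThird_le_of_lintegral_le {c : ℝ} (hc : 0 ≤ c)
    (h : ∫⁻ x : ℝ≥0, ENNReal.ofReal (|(x : ℝ) - 1| ^ 3) ∂(ν : Measure ℝ≥0) ≤ ENNReal.ofReal c) :
    absThird ν ≤ c := by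
  rw [absThird, integral_eq_lintegral_of_nonneg_ae (ae_of_all _ fun a => by positivity)
    (by fun_prop)]
  exact ENNReal.toReal_le_of_le_ofReal hc h

/-- Write `x y - 1 = (x - 1) + x (y - 1)` and integrate the centred `y` first. The cross term
carries `x ^ 2`, which is bounded by `2 + 2 |x - 1| ^ 2`; hence the factors 6. -/
theorem absThird_mulProb_le (hν : moment 1 ν = 1) (hμ3 : moment 3 μ < ⊤) (hν3 : moment 3 ν < ⊤) :
    absThird (mulProb μ ν) ≤ absThird μ * (1 + 6 * var ν) + 6 * var ν * √(var μ) +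
      (moment 3 μ).toReal * absThird ν := by
  have hv : 0 ≤ var ν := var_nonneg
  have ha : 0 ≤ absThird μ := absThird_nonneg
  have ha' : 0 ≤ absThird ν := absThird_nonneg
  refine absThird_le_of_lintegral_le (by positivity) ?_
  rw [coe_mulProb, lintegral_mulLaw _ _ (by fun_prop)]
  have step (x : ℝ≥0) : ∫⁻ y : ℝ≥0, ENNReal.ofReal (|((x * y : ℝ≥0) : ℝ) - 1| ^ 3)
      ∂(ν : Measure ℝ≥0) ≤ ENNReal.ofReal ((1 + 6 * var ν) * |(x : ℝ) - 1| ^ 3 +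
        6 * var ν * |(x : ℝ) - 1| + absThird ν * (x : ℝ) ^ 3) := by
    have e (y : ℝ≥0) : ((x * y : ℝ≥0) : ℝ) - 1 = ((x : ℝ) - 1) + x * ((y : ℝ) - 1) := by
      push_cast; ring
    simp_rw [e]
    refine (lintegral_abs_add_pow_three_le ((memLp_sub_one_three hν3).const_mul (x : ℝ))
      (by rw [integral_const_mul, integral_coe_sub_one hν (moment_two_lt_top_of_three hν3),
        mul_zero]) _).trans (ENNReal.ofReal_le_ofReal ?_)
    simp_rw [mul_pow, abs_mul, mul_pow, integral_const_mul]
    rw [← var, ← absThird, abs_of_nonneg x.coe_nonneg]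
    have hx : (x : ℝ) ^ 2 ≤ 2 + 2 * |(x : ℝ) - 1| ^ 2 := by
      rw [sq_abs]; nlinarith [sq_nonneg ((x : ℝ) - 2)]
    have : 3 * |(x : ℝ) - 1| * (x ^ 2 * var ν) ≤
        3 * |(x : ℝ) - 1| * ((2 + 2 * |(x : ℝ) - 1| ^ 2) * var ν) := by gcongr
    linarith
  refine (lintegral_mono fun x => step x).trans ?_
  have i1 : Integrable (fun x : ℝ≥0 => (1 + 6 * var ν) * |(x : ℝ) - 1| ^ 3) (μ : Measure ℝ≥0) :=
    (integrable_abs_pow_three (memLp_sub_one_three hμ3)).const_mul _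
  have i2 : Integrable (fun x : ℝ≥0 => 6 * var ν * |(x : ℝ) - 1|) (μ : Measure ℝ≥0) :=
    ((memLp_sub_one_three hμ3).integrable (by norm_num)).abs.const_mul _
  have i3 : Integrable (fun x : ℝ≥0 => absThird ν * (x : ℝ) ^ 3) (μ : Measure ℝ≥0) := by
    have := integrable_abs_pow_three (memLp_three hμ3)
    simp only [NNReal.abs_eq] at this
    exact this.const_mul _
  have i12 : Integrable (fun x : ℝ≥0 => (1 + 6 * var ν) * |(x : ℝ) - 1| ^ 3 +
      6 * var ν * |(x : ℝ) - 1|) (μ : Measure ℝ≥0) := i1.add i2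
  have i123 : Integrable (fun x : ℝ≥0 => (1 + 6 * var ν) * |(x : ℝ) - 1| ^ 3 +
      6 * var ν * |(x : ℝ) - 1| + absThird ν * (x : ℝ) ^ 3) (μ : Measure ℝ≥0) := i12.add i3
  rw [← ofReal_integral_eq_lintegral_ofReal i123 (ae_of_all _ fun x => by positivity)]
  refine ENNReal.ofReal_le_ofReal ?_
  rw [integral_add i12 i3, integral_add i1 i2, integral_const_mul, integral_const_mul,
    integral_const_mul, integral_pow_eq_toReal, ← moment_three, ← absThird]
  have := integral_abs_sub_one_le (moment_two_lt_top_of_three hμ3)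
  have : 6 * var ν * ∫ x : ℝ≥0, |(x : ℝ) - 1| ∂(μ : Measure ℝ≥0) ≤ 6 * var ν * √(var μ) := by
    gcongr
  linarith

theorem absThird_smoothing_le {b : ℕ} (hb : b ≠ 0) (hμ : moment 1 μ = 1) (hν : moment 1 ν = 1)
    (hμ3 : moment 3 μ < ⊤) (hν3 : moment 3 ν < ⊤) :
    b ^ 2 * absThird (smoothing b μ ν) ≤ absThird (mulProb μ ν) +
      3 * b * √(var (mulProb μ ν)) ^ 3 := by
  have hb' : (0 : ℝ) < b := by positivity
  have h3 : moment 3 (mulProb μ ν) < ⊤ := by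
    rw [moment_three_mulProb]
    exact ENNReal.mul_lt_top hμ3 hν3
  have h2 := moment_two_lt_top_of_three h3
  have hc : 0 ≤ absThird (mulProb μ ν) := absThird_nonneg
  have key : absThird (smoothing b μ ν) ≤ (b : ℝ)⁻¹ ^ 3 * (b * absThird (mulProb μ ν) +
      3 * b ^ 2 * √(var (mulProb μ ν)) ^ 3) := by
    refine absThird_le_of_lintegral_le (by positivity) ?_
    rw [coe_smoothing_eq_map_pi, lintegral_map (by fun_prop) (by fun_prop)]
    have e (z : Fin b → ℝ≥0) : ENNReal.ofReal (|(((b : ℝ≥0)⁻¹ * ∑ j, z j : ℝ≥0) : ℝ) - 1| ^ 3) =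
        ENNReal.ofReal ((b : ℝ)⁻¹ ^ 3) * ENNReal.ofReal (|∑ j, ((z j : ℝ) - 1)| ^ 3) := by
      suffices e' : (((b : ℝ≥0)⁻¹ * ∑ j, z j : ℝ≥0) : ℝ) - 1 = (b : ℝ)⁻¹ * ∑ j, ((z j : ℝ) - 1) by
        rw [← ENNReal.ofReal_mul (by positivity), e', abs_mul, mul_pow,
          abs_of_pos (inv_pos.2 hb')]
      rw [Finset.sum_sub_distrib]
      push_cast
      rw [mul_sub]
      simp [hb'.ne']
    simp_rw [e]
    rw [lintegral_const_mul _ (by fun_prop), ENNReal.ofReal_mul (by positivity)]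
    gcongr
    exact lintegral_abs_sum_pow_three_le (ρ := (mulProb μ ν : Measure ℝ≥0))
      (Z := fun x : ℝ≥0 => (x : ℝ) - 1) (by fun_prop) (memLp_sub_one_three h3)
      (integral_coe_sub_one (moment_one_mulProb hμ hν) h2) (Real.sqrt_nonneg _)
      (by rw [Real.sq_sqrt var_nonneg, var]) le_rfl b
  refine (mul_le_mul_of_nonneg_left key (by positivity)).trans_eq ?_
  field_simp

end Bounds

/-! ### Boundedness of the normalized third moment. -/

section Recursion

variable {b : ℕ} {μ : ProbabilityMeasure ℝ≥0}

theorem var_mulProb_T (hμ : μ ∈ P b) : var (mulProb μ (T b μ)) = b * var (T b μ) := by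
  have hv := var_lt_of_mem_P hμ
  have h := one_add_var_mulProb hμ.1 (moment_one_T hμ) (moment_two_lt_top_of_mem_P hμ)
    (moment_two_T_lt_top hμ)
  have h' := var_T hμ
  rw [eq_div_iff (by linarith)] at h'
  linarith

/-- The fixed-point equation puts the third absolute moment of `T b μ` on both sides of the
estimate. It is finite by `h3'`, so its contribution with factor `moment 3 μ` moves to the left;
every remaining variance term is of order `√(var μ) ^ 3`. -/
theorem absThird_T_le (hμ : μ ∈ P b) (h3 : moment 3 μ < ⊤) (h3' : moment 3 (T b μ) < ⊤) :
    (b ^ 2 - (moment 3 μ).toReal) * absThird (T b μ) ≤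
      absThird μ * (1 + 6 * var μ) + (6 + 3 * b ^ 4) * √(var μ) ^ 3 := by
  have hb := three_le_of_mem_P hμ
  have hb' : (3 : ℝ) ≤ b := by exact_mod_cast hb
  have h0 := var_pos_of_mem_P hμ
  have hv : var (T b μ) ≤ var μ := var_iterate_succ_le hμ 0
  have ha : 0 ≤ absThird μ := absThird_nonneg
  have hv0 : 0 ≤ var (T b μ) := var_nonneg
  have h1 := absThird_smoothing_le (b := b) (by omega) hμ.1 (moment_one_T hμ) h3 h3'
  rw [smoothing_T hμ, var_mulProb_T hμ] at h1
  have h2 := absThird_mulProb_le (moment_one_T hμ) h3 h3'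
  have hs : √(b * var (T b μ)) ≤ b * √(var μ) := by
    rw [← Real.sqrt_sq (show (0 : ℝ) ≤ b by linarith), ← Real.sqrt_mul (sq_nonneg _),
      Real.sqrt_sq (show (0 : ℝ) ≤ b by linarith)]
    refine Real.sqrt_le_sqrt ?_
    have : (b : ℝ) * var (T b μ) ≤ b * var μ := by gcongr
    exact this.trans (mul_le_mul_of_nonneg_right (by nlinarith) h0.le)
  have e1 : 3 * (b : ℝ) * √(b * var (T b μ)) ^ 3 ≤ 3 * b * (b * √(var μ)) ^ 3 := by gcongr
  have e2 : absThird μ * (1 + 6 * var (T b μ)) ≤ absThird μ * (1 + 6 * var μ) := by gcongr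
  have e3 : 6 * var (T b μ) * √(var μ) ≤ 6 * √(var μ) ^ 3 := by
    rw [pow_succ, Real.sq_sqrt h0.le, ← mul_assoc]
    gcongr
  have e4 : 3 * (b : ℝ) * (b * √(var μ)) ^ 3 = 3 * b ^ 4 * √(var μ) ^ 3 := by ring
  linarith

theorem exists_bound_of_eventually_contract {r : ℕ → ℝ} {ρ L : ℝ} (hρ0 : 0 ≤ ρ) (hρ : ρ < 1)
    (h : ∀ᶠ n in atTop, r (n + 1) ≤ ρ * r n + L) : ∃ R, ∀ n, r n ≤ R := by
  obtain ⟨N, hN⟩ := eventually_atTop.1 h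
  have hbd : BddAbove (Set.range r) := by
    refine (isBoundedUnder_of_eventually_le (a := max (r N) (L / (1 - ρ))) ?_).bddAbove_range
    filter_upwards [eventually_ge_atTop N] with n hn
    induction n, hn using Nat.le_induction with
    | base => exact le_max_left _ _
    | succ n hn ih =>
      have h1 : L ≤ (1 - ρ) * max (r N) (L / (1 - ρ)) := by
        have h2 := le_max_right (r N) (L / (1 - ρ))
        rwa [div_le_iff₀' (by linarith)] at h2
      have h3 : ρ * r n ≤ ρ * max (r N) (L / (1 - ρ)) := by gcongr
      linarith [hN n hn]
  obtain ⟨R, hR⟩ := hbd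
  exact ⟨R, fun n => hR ⟨n, rfl⟩⟩

theorem sigma_sq_eq_mul (hμ : μ ∈ P b) (n : ℕ) :
    sigma b μ n ^ 2 = (b - 1 - var ((T b)^[n] μ)) * sigma b μ (n + 1) ^ 2 := by
  have hv := var_lt_of_mem_P (iterate_T_mem_P hμ n)
  rw [sigma_sq, sigma_sq, var_iterate_succ hμ]
  have : (b : ℝ) - 1 - var ((T b)^[n] μ) ≠ 0 := by linarith
  field_simp

theorem sigma_le_sqrt_mul (hμ : μ ∈ P b) (n : ℕ) :
    sigma b μ n ≤ √(b - 1) * sigma b μ (n + 1) := by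
  have hb : (3 : ℝ) ≤ b := by exact_mod_cast three_le_of_mem_P hμ
  have h0 := var_pos_of_mem_P (iterate_T_mem_P hμ n)
  have hs := sigma_pos hμ (n + 1)
  refine le_of_sq_le_sq ?_ (by positivity)
  rw [mul_pow, Real.sq_sqrt (by linarith), sigma_sq_eq_mul hμ]
  exact mul_le_mul_of_nonneg_right (by linarith) (sq_nonneg _)

theorem exists_absThird_le (hμ : μ ∈ D b) :
    ∃ R, ∀ n, moment 3 ((T b)^[n] μ) < ⊤ ∧ absThird ((T b)^[n] μ) / sigma b μ n ^ 3 ≤ R := by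
  have hP := D_subset_P hμ
  have hb : (3 : ℝ) ≤ b := by exact_mod_cast three_le_of_mem_P hP
  obtain ⟨m, hm, hev⟩ := exists_third_moment_bound hμ
  have hfin (n : ℕ) : moment 3 ((T b)^[n] μ) < ⊤ := (hm n).2.trans_lt ENNReal.ofReal_lt_top
  set g := √((b : ℝ) - 1) with hg
  have hg2 : g ^ 2 = b - 1 := Real.sq_sqrt (by linarith)
  have hg0 : 0 < g := Real.sqrt_pos.2 (by linarith)
  set κ := 2 * g ^ 3 / b ^ 2 with hκ
  have hκ0 : 0 ≤ κ := by positivity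
  -- From `2 √(b - 1) ≤ b` one gets `κ ≤ (b - 1) / b`.
  have hκ1 : κ < 1 := by
    rw [hκ, div_lt_one (by positivity)]
    have : 2 * g ≤ b := by nlinarith [sq_nonneg ((b : ℝ) - 2)]
    nlinarith
  have hlim : Tendsto (fun n => κ * (1 + 6 * var ((T b)^[n] μ))) atTop (𝓝 κ) := by
    simpa using (((tendsto_var hP).const_mul 6).const_add 1).const_mul κ
  -- The vanishing variance lets the perturbed factor be replaced by the midpoint between `κ` and 1.
  have hev2 : ∀ᶠ n in atTop, κ * (1 + 6 * var ((T b)^[n] μ)) ≤ (1 + κ) / 2 :=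
    hlim.eventually_le_const (by linarith)
  obtain ⟨R, hR⟩ := exists_bound_of_eventually_contract
    (r := fun n => absThird ((T b)^[n] μ) / sigma b μ n ^ 3) (ρ := (1 + κ) / 2)
    (L := κ * (6 + 3 * b ^ 4)) (by linarith) (by linarith) (by
      filter_upwards [hev, hev2] with n hn hn2
      have hs := sigma_pos hP n
      have hs' := sigma_pos hP (n + 1)
      have h := absThird_T_le (iterate_T_mem_P hP n) (hfin n)
        (by rw [← Function.iterate_succ_apply' (T b)]; exact hfin (n + 1))
      rw [← Function.iterate_succ_apply' (T b), ← sigma_sq, Real.sqrt_sq hs.le] at h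
      rw [← sigma_sq] at hn2
      have ha' : 0 ≤ absThird ((T b)^[n + 1] μ) := absThird_nonneg
      have ha : 0 ≤ absThird ((T b)^[n] μ) := absThird_nonneg
      have hmn : (moment 3 ((T b)^[n] μ)).toReal ≤ b ^ 2 / 2 := by
        refine (ENNReal.toReal_le_of_le_ofReal (b := max (m n) 0) (le_max_right _ _)
          ((hm n).2.trans (ENNReal.ofReal_le_ofReal (le_max_left _ _)))).trans
          (max_le hn (by positivity))
      have h' : b ^ 2 / 2 * absThird ((T b)^[n + 1] μ) ≤ absThird ((T b)^[n] μ) *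
          (1 + 6 * sigma b μ n ^ 2) + (6 + 3 * b ^ 4) * sigma b μ n ^ 3 := by
        refine le_trans ?_ h
        gcongr
        linarith
      have hsg : sigma b μ n ^ 3 ≤ g ^ 3 * sigma b μ (n + 1) ^ 3 := by
        rw [← mul_pow]
        gcongr
        exact sigma_le_sqrt_mul hP n
      set a := absThird ((T b)^[n] μ)
      set a' := absThird ((T b)^[n + 1] μ)
      set s := sigma b μ n
      set s' := sigma b μ (n + 1)
      set X := a / s ^ 3 * (1 + 6 * s ^ 2) + (6 + 3 * b ^ 4) with hX
      have hX0 : 0 ≤ X := by positivity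
      have e : a * (1 + 6 * s ^ 2) + (6 + 3 * b ^ 4) * s ^ 3 = X * s ^ 3 := by
        rw [hX]; field_simp
      have hX2 : a' / s' ^ 3 ≤ κ * X := by
        rw [div_le_iff₀ (by positivity), hκ]
        have : b ^ 2 / 2 * a' ≤ X * (g ^ 3 * s' ^ 3) := by
          rw [e] at h'
          exact h'.trans (by gcongr)
        calc a' = 2 / b ^ 2 * (b ^ 2 / 2 * a') := by field_simp
          _ ≤ 2 / b ^ 2 * (X * (g ^ 3 * s' ^ 3)) := by gcongr
          _ = _ := by ring
      refine hX2.trans ?_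
      have : κ * (1 + 6 * s ^ 2) * (a / s ^ 3) ≤ (1 + κ) / 2 * (a / s ^ 3) := by gcongr
      rw [hX]
      linarith)
  exact ⟨R, fun n => ⟨hfin n, hR n⟩⟩

theorem iSup_normalizedMoment_three_lt_top (hμ : μ ∈ D b) :
    (⨆ n ≥ 1, normalizedMoment b μ 3 n) < ⊤ := by
  have hP := D_subset_P hμ
  obtain ⟨R, hR⟩ := exists_absThird_le hμ
  refine lt_of_le_of_lt (iSup₂_le fun n _ => ?_) (ENNReal.ofReal_lt_top (r := R))
  have hs := sigma_pos hP n
  have e (x : ℝ≥0) : ENNReal.ofReal ((|(x : ℝ) - 1| / sigma b μ n) ^ (3 : ℝ)) =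
      ENNReal.ofReal ((sigma b μ n ^ 3)⁻¹) * ENNReal.ofReal (|(x : ℝ) - 1| ^ 3) := by
    rw [← ENNReal.ofReal_mul (by positivity)]
    congr 1
    rw [show (3 : ℝ) = ((3 : ℕ) : ℝ) by norm_num, Real.rpow_natCast, div_pow]
    field_simp
  rw [normalizedMoment]
  simp_rw [e]
  rw [lintegral_const_mul _ (by fun_prop), lintegral_abs_sub_one_pow_three (hR n).1,
    ← ENNReal.ofReal_mul (by positivity)]
  refine ENNReal.ofReal_le_ofReal (le_trans (le_of_eq ?_) (hR n).2)
  field_simp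

end Recursion

/-! ### Central limit theorem for the standardized laws. -/

theorem norm_integral_cexp_sub_taylor_le {α : Type*} [MeasurableSpace α] {ρ : Measure α}
    [IsProbabilityMeasure ρ] {X : α → ℝ} (hX : MemLp X 2 ρ) (h0 : ∫ a, X a ∂ρ = 0)
    (h1 : ∫ a, X a ^ 2 ∂ρ = 1) {q : ℝ} (hq2 : 2 ≤ q) (hq3 : q ≤ 3)
    (hq : Integrable (fun a => |X a| ^ q) ρ) (s : ℝ) :
    ‖∫ a, Complex.exp (s * X a * Complex.I) ∂ρ - 1 + s ^ 2 / 2‖ ≤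
      4 * (∫ a, |X a| ^ q ∂ρ) * |s| ^ q := by
  have i0 : Integrable (fun a => Complex.exp ((s * X a : ℝ) * Complex.I)) ρ :=
    Integrable.of_bound (C := 1)
      ((by fun_prop : Measurable fun x : ℝ =>
        Complex.exp ((s * x : ℝ) * Complex.I)).comp_aemeasurable
        hX.aestronglyMeasurable.aemeasurable).aestronglyMeasurable
      (ae_of_all _ fun x => (Complex.norm_exp_ofReal_mul_I _).le)
  have i1 : Integrable (fun a => Complex.exp ((s * X a : ℝ) * Complex.I) - 1) ρ :=
    i0.sub (integrable_const _)
  have iX : Integrable (fun a => ((s * X a : ℝ) : ℂ) * Complex.I) ρ :=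
    ((hX.integrable (by norm_num)).const_mul s).ofReal.mul_const _
  have i2 : Integrable (fun a => Complex.exp ((s * X a : ℝ) * Complex.I) - 1 -
      ((s * X a : ℝ) : ℂ) * Complex.I) ρ := i1.sub iX
  have iX2 : Integrable (fun a => (((s * X a) ^ 2 / 2 : ℝ) : ℂ)) ρ := by
    simp_rw [mul_pow]
    exact ((hX.integrable_sq.const_mul _).div_const _).ofReal
  have e : ∫ a, Complex.exp (s * X a * Complex.I) ∂ρ - 1 + s ^ 2 / 2 =
      ∫ a, (Complex.exp ((s * X a : ℝ) * Complex.I) - 1 - ((s * X a : ℝ) : ℂ) * Complex.I +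
        (((s * X a) ^ 2 / 2 : ℝ) : ℂ)) ∂ρ := by
    rw [integral_add i2 iX2, integral_sub i1 iX, integral_sub i0 (integrable_const _),
      integral_mul_const, integral_complex_ofReal, integral_complex_ofReal, integral_const_mul, h0,
      integral_div]
    simp_rw [mul_pow]
    rw [integral_const_mul, h1]
    simp
  rw [e]
  have hb : Integrable (fun a => 4 * |s| ^ q * |X a| ^ q) ρ := hq.const_mul _
  refine (norm_integral_le_of_norm_le hb (ae_of_all _ fun a => ?_)).trans_eq ?_
  · rw [mul_assoc, ← Real.mul_rpow (abs_nonneg _) (abs_nonneg _), ← abs_mul]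
    have := norm_cexp_mul_I_sub_taylor_two_le (s * X a) hq2 hq3
    push_cast at this ⊢
    exact this
  · rw [integral_const_mul]
    ring

theorem gaussian_taylor_bound {q : ℝ} (hq2 : 2 ≤ q) (hq3 : q ≤ 3) :
    ∃ K : ℝ, 0 ≤ K ∧ ∀ s : ℝ, ‖charFun (gaussianReal 0 1) s - 1 + s ^ 2 / 2‖ ≤ K * |s| ^ q := by
  have hm (p : ℝ≥0) : MemLp id p (gaussianReal 0 1) := memLp_id_gaussianReal p
  have h2 : MemLp (fun x : ℝ => x) 2 (gaussianReal 0 1) := by simpa using! hm 2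
  have h0 : ∫ x, x ∂(gaussianReal 0 1) = 0 := integral_id_gaussianReal
  have h1 : ∫ x, x ^ 2 ∂(gaussianReal 0 1) = 1 := by
    have hv : Var[fun x : ℝ => x; gaussianReal 0 1] = 1 := by simp
    rw [variance_eq_sub h2] at hv
    simpa [h0] using hv
  have hq : Integrable (fun x : ℝ => |x| ^ q) (gaussianReal 0 1) := by
    have h := (hm q.toNNReal).integrable_norm_rpow (by simp; linarith) (by simp)
    simpa [Real.coe_toNNReal q (by linarith)] using h
  refine ⟨4 * ∫ x, |x| ^ q ∂(gaussianReal 0 1), ?_, fun s => ?_⟩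
  · have : 0 ≤ ∫ x, |x| ^ q ∂(gaussianReal 0 1) := integral_nonneg fun x => by positivity
    positivity
  · rw [charFun_apply_real]
    exact norm_integral_cexp_sub_taylor_le h2 h0 h1 hq2 hq3 hq s

/-- The characteristic function of the standardized variable `(W_n - 1) / σ_n`. -/
noncomputable def stdCf (b : ℕ) (μ : ProbabilityMeasure ℝ≥0) (n : ℕ) (s : ℝ) : ℂ :=
  ∫ x : ℝ≥0, Complex.exp (s * (((x : ℝ) - 1) / sigma b μ n : ℝ) * Complex.I)
    ∂((T b)^[n] μ : Measure ℝ≥0)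

section Standardized

variable {b : ℕ} {μ : ProbabilityMeasure ℝ≥0}

theorem norm_stdCf_le_one (n : ℕ) (s : ℝ) : ‖stdCf b μ n s‖ ≤ 1 :=
  (norm_integral_le_of_norm_le_const (C := 1)
    (ae_of_all _ fun _ => (norm_cexp_mul_I _ _).le)).trans (by simp)

theorem memLp_std (hμ : μ ∈ P b) (n : ℕ) :
    MemLp (fun x : ℝ≥0 => ((x : ℝ) - 1) / sigma b μ n) 2 ((T b)^[n] μ : Measure ℝ≥0) := by
  simp_rw [div_eq_mul_inv]
  exact MemLp.mul_const (memLp_sub_one_two (moment_two_lt_top_of_mem_P (iterate_T_mem_P hμ n))) _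

theorem integral_std (hμ : μ ∈ P b) (n : ℕ) :
    ∫ x : ℝ≥0, ((x : ℝ) - 1) / sigma b μ n ∂((T b)^[n] μ : Measure ℝ≥0) = 0 := by
  rw [integral_div, integral_coe_sub_one (iterate_T_mem_P hμ n).1
    (moment_two_lt_top_of_mem_P (iterate_T_mem_P hμ n)), zero_div]

theorem integral_std_sq (hμ : μ ∈ P b) (n : ℕ) :
    ∫ x : ℝ≥0, (((x : ℝ) - 1) / sigma b μ n) ^ 2 ∂((T b)^[n] μ : Measure ℝ≥0) = 1 := by
  simp_rw [div_pow]
  rw [integral_div, ← var, ← sigma_sq, div_self]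
  exact pow_ne_zero _ (sigma_pos hμ n).ne'

theorem integral_abs_std_le (hμ : μ ∈ P b) (n : ℕ) :
    ∫ x : ℝ≥0, |((x : ℝ) - 1) / sigma b μ n| ∂((T b)^[n] μ : Measure ℝ≥0) ≤ 1 :=
  integral_abs_le_of_integral_sq_eq (memLp_std hμ n) zero_le_one
    (by rw [integral_std_sq hμ, one_pow])

/-- The bound `|y| ^ q ≤ 1 + |y| ^ p` lowers the exponent to one admissible in the Taylor estimate,
with a constant independent of `n`. -/
theorem stdCf_taylor_bound (hμ : μ ∈ P b) {p q : ℝ} (hq2 : 2 ≤ q) (hq3 : q ≤ 3) (hqp : q ≤ p)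
    (hp : (⨆ n ≥ 1, normalizedMoment b μ p n) < ⊤) :
    ∃ K : ℝ, 0 ≤ K ∧ ∀ n ≥ 1, ∀ s : ℝ, ‖stdCf b μ n s - 1 + s ^ 2 / 2‖ ≤ K * |s| ^ q := by
  set M := (⨆ n ≥ 1, normalizedMoment b μ p n).toReal
  have hM0 : 0 ≤ M := ENNReal.toReal_nonneg
  refine ⟨4 * (1 + M), by positivity, fun n hn s => ?_⟩
  have hs := sigma_pos hμ n
  have hmeas (r : ℝ) : Measurable fun x : ℝ≥0 => |((x : ℝ) - 1) / sigma b μ n| ^ r := by fun_prop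
  have hnm : ∫⁻ x : ℝ≥0, ENNReal.ofReal (|((x : ℝ) - 1) / sigma b μ n| ^ p)
      ∂((T b)^[n] μ : Measure ℝ≥0) ≤ ENNReal.ofReal M := by
    rw [ENNReal.ofReal_toReal hp.ne]
    have e (x : ℝ≥0) : |((x : ℝ) - 1) / sigma b μ n| = |(x : ℝ) - 1| / sigma b μ n := by
      rw [abs_div, abs_of_pos hs]
    simp_rw [e]
    exact le_iSup₂ (f := fun n (_ : n ≥ 1) => normalizedMoment b μ p n) n hn
  have hint : Integrable (fun x : ℝ≥0 => |((x : ℝ) - 1) / sigma b μ n| ^ p)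
      ((T b)^[n] μ : Measure ℝ≥0) := by
    refine (lintegral_ofReal_ne_top_iff_integrable (hmeas p).aestronglyMeasurable
      (ae_of_all _ fun x => by positivity)).1 (hnm.trans_lt ENNReal.ofReal_lt_top).ne
  have hle : ∫ x : ℝ≥0, |((x : ℝ) - 1) / sigma b μ n| ^ p ∂((T b)^[n] μ : Measure ℝ≥0) ≤ M := by
    rw [integral_eq_lintegral_of_nonneg_ae (ae_of_all _ fun x => by positivity)
      (hmeas p).aestronglyMeasurable]
    exact ENNReal.toReal_le_of_le_ofReal hM0 hnm
  have hpt (y : ℝ) : |y| ^ q ≤ 1 + |y| ^ p := by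
    rcases le_total |y| 1 with h | h
    · have := Real.rpow_le_one (abs_nonneg y) h (by linarith : 0 ≤ q)
      have : 0 ≤ |y| ^ p := by positivity
      linarith
    · have := Real.rpow_le_rpow_of_exponent_le h hqp
      linarith
  have hdom : Integrable (fun x : ℝ≥0 => 1 + |((x : ℝ) - 1) / sigma b μ n| ^ p)
      ((T b)^[n] μ : Measure ℝ≥0) := (integrable_const _).add hint
  have hintq : Integrable (fun x : ℝ≥0 => |((x : ℝ) - 1) / sigma b μ n| ^ q)
      ((T b)^[n] μ : Measure ℝ≥0) :=
    hdom.mono' (hmeas q).aestronglyMeasurable (ae_of_all _ fun x => by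
      rw [Real.norm_of_nonneg (by positivity)]; exact hpt _)
  have hleq : ∫ x : ℝ≥0, |((x : ℝ) - 1) / sigma b μ n| ^ q ∂((T b)^[n] μ : Measure ℝ≥0) ≤
      1 + M := by
    refine (integral_mono hintq hdom fun x => hpt _).trans ?_
    rw [integral_add (integrable_const _) hint]
    simpa using hle
  refine (norm_integral_cexp_sub_taylor_le (memLp_std hμ n) (integral_std hμ n)
    (integral_std_sq hμ n) hq2 hq3 hintq s).trans ?_
  gcongr

theorem stdCf_eq_cf (n : ℕ) (s : ℝ) :
    stdCf b μ n s = cf ((T b)^[n] μ) (s / sigma b μ n) *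
      Complex.exp (-(s / sigma b μ n : ℝ) * Complex.I) := by
  rw [stdCf, cf, ← integral_mul_const]
  congr 1
  ext x
  rw [← Complex.exp_add]
  congr 1
  push_cast
  ring

/-- The law at time `n + 1` is fixed by smoothing with the law at time `n`, so it appears on both
sides. The centring phase is split evenly among the `b` factors. -/
theorem stdCf_succ (hμ : μ ∈ P b) (n : ℕ) (s : ℝ) :
    stdCf b μ (n + 1) s =
      (∫ p : ℝ≥0 × ℝ≥0, Complex.exp ((s / b : ℝ) *
          (((p.1 : ℝ) * p.2 - 1) / sigma b μ (n + 1) : ℝ) * Complex.I)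
        ∂(((T b)^[n] μ : Measure ℝ≥0).prod ((T b)^[n + 1] μ : Measure ℝ≥0))) ^ b := by
  have hb : (b : ℂ) ≠ 0 := by
    have := three_le_of_mem_P hμ
    exact_mod_cast (by omega : b ≠ 0)
  have hfix : (T b)^[n + 1] μ = smoothing b ((T b)^[n] μ) ((T b)^[n + 1] μ) := by
    rw [Function.iterate_succ_apply', smoothing_T (iterate_T_mem_P hμ n)]
  rw [stdCf_eq_cf]
  conv_lhs => rw [hfix]
  rw [cf_smoothing_eq_prod]
  have e : Complex.exp (-(s / sigma b μ (n + 1) : ℝ) * Complex.I) =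
      Complex.exp (-(s / sigma b μ (n + 1) / b : ℝ) * Complex.I) ^ b := by
    rw [← Complex.exp_nat_mul]
    congr 1
    push_cast
    field_simp
  rw [e, ← mul_pow, ← integral_mul_const]
  congr 2
  ext p
  rw [← Complex.exp_add]
  congr 1
  push_cast
  ring

theorem norm_cexp_mul_I_sub_cexp_mul_I_le (x y : ℝ) :
    ‖Complex.exp (x * Complex.I) - Complex.exp (y * Complex.I)‖ ≤ |x - y| := by
  have e : Complex.exp (x * Complex.I) - Complex.exp (y * Complex.I) =
      Complex.exp (y * Complex.I) * (Complex.exp (Complex.I * (x - y : ℝ)) - 1) := by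
    rw [mul_sub, ← Complex.exp_add, mul_one]
    congr 2
    push_cast
    ring
  rw [e, norm_mul, Complex.norm_exp_ofReal_mul_I, one_mul]
  exact Real.norm_exp_I_mul_ofReal_sub_one_le

/-- With standardized `X`, `Y` and deviations `σ`, `σ'`, one has `(W Y - 1) / σ' = (σ / σ') X + Y +
σ X Y`. Replacing `σ / σ'` by `c` and dropping the last term costs the stated error, since `X` and
`Y` have mean absolute value at most one. -/
theorem norm_integral_prod_sub_mul_stdCf_le (hμ : μ ∈ P b) (n : ℕ) (c u : ℝ) :
    ‖∫ p : ℝ≥0 × ℝ≥0, Complex.exp ((u : ℝ) *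
          (((p.1 : ℝ) * p.2 - 1) / sigma b μ (n + 1) : ℝ) * Complex.I)
        ∂(((T b)^[n] μ : Measure ℝ≥0).prod ((T b)^[n + 1] μ : Measure ℝ≥0)) -
      stdCf b μ n (c * u) * stdCf b μ (n + 1) u‖ ≤
    |u| * (|sigma b μ n / sigma b μ (n + 1) - c| + sigma b μ n) := by
  have hs := sigma_pos hμ n
  have hs' := sigma_pos hμ (n + 1)
  set ν := ((T b)^[n] μ : Measure ℝ≥0)
  set ν' := ((T b)^[n + 1] μ : Measure ℝ≥0)
  set σ := sigma b μ n
  set σ' := sigma b μ (n + 1)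
  let X : ℝ≥0 → ℝ := fun x => ((x : ℝ) - 1) / σ
  let Y : ℝ≥0 → ℝ := fun x => ((x : ℝ) - 1) / σ'
  have hprod : stdCf b μ n (c * u) * stdCf b μ (n + 1) u =
      ∫ p : ℝ≥0 × ℝ≥0, Complex.exp ((c * u * X p.1 + u * Y p.2 : ℝ) * Complex.I) ∂(ν.prod ν') := by
    rw [stdCf, stdCf, ← integral_prod_mul]
    congr 1
    ext p
    rw [← Complex.exp_add]
    congr 1
    simp only [X, Y, σ, σ']
    push_cast
    ring
  have iX : Integrable (fun x => |X x|) ν := ((memLp_std hμ n).integrable (by norm_num)).abs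
  have iY : Integrable (fun x => |Y x|) ν' :=
    ((memLp_std hμ (n + 1)).integrable (by norm_num)).abs
  have j1 : Integrable (fun p : ℝ≥0 × ℝ≥0 => |X p.1|) (ν.prod ν') := iX.comp_fst ν'
  have j2 : Integrable (fun p : ℝ≥0 × ℝ≥0 => |X p.1| * |Y p.2|) (ν.prod ν') := iX.mul_prod iY
  have k1 : Integrable (fun p : ℝ≥0 × ℝ≥0 => |u| * (|σ / σ' - c| * |X p.1|)) (ν.prod ν') :=
    (j1.const_mul _).const_mul _
  have k2 : Integrable (fun p : ℝ≥0 × ℝ≥0 => |u| * (σ * (|X p.1| * |Y p.2|))) (ν.prod ν') :=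
    (j2.const_mul _).const_mul _
  rw [hprod, ← integral_sub]
  rotate_left
  · exact Integrable.of_bound (C := 1) (by fun_prop)
      (ae_of_all _ fun p => (norm_cexp_mul_I _ _).le)
  · exact Integrable.of_bound (C := 1) (by fun_prop)
      (ae_of_all _ fun p => (Complex.norm_exp_ofReal_mul_I _).le)
  refine (norm_integral_le_of_norm_le (k1.add k2) (ae_of_all _ fun p => ?_)).trans ?_
  · rw [← Complex.ofReal_mul]
    refine (norm_cexp_mul_I_sub_cexp_mul_I_le _ _).trans ?_
    have e : u * (((p.1 : ℝ) * p.2 - 1) / σ') - (c * u * X p.1 + u * Y p.2) =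
        u * ((σ / σ' - c) * X p.1 + σ * (X p.1 * Y p.2)) := by
      simp only [X, Y]
      field_simp
      ring
    rw [e, abs_mul, Pi.add_apply, ← mul_add]
    gcongr
    refine (abs_add_le _ _).trans ?_
    rw [abs_mul, abs_mul, abs_mul, abs_of_pos hs]
  · simp only [Pi.add_apply]
    have hX1 : ∫ x, |X x| ∂ν ≤ 1 := integral_abs_std_le hμ n
    have hY1 : ∫ x, |Y x| ∂ν' ≤ 1 := integral_abs_std_le hμ (n + 1)
    have hX0 : 0 ≤ ∫ x, |X x| ∂ν := integral_nonneg fun _ => abs_nonneg _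
    have hY0 : 0 ≤ ∫ x, |Y x| ∂ν' := integral_nonneg fun _ => abs_nonneg _
    rw [integral_add k1 k2, integral_const_mul, integral_const_mul, integral_const_mul,
      integral_const_mul, integral_prod_mul (fun x => |X x|) (fun x => |Y x|),
      integral_fun_fst (fun x => |X x|), ← mul_add]
    have : (∫ x, |X x| ∂ν) * ∫ x, |Y x| ∂ν' ≤ 1 := mul_le_one₀ hX1 hY0 hY1
    simp only [probReal_univ, one_smul]
    gcongr
    · exact mul_le_of_le_one_right (abs_nonneg _) hX1
    · exact mul_le_of_le_one_right hs.le this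

theorem tendsto_sigma_div (hμ : μ ∈ P b) :
    Tendsto (fun n => sigma b μ n / sigma b μ (n + 1)) atTop (𝓝 √(b - 1)) := by
  have h : Tendsto (fun n => √(b - 1 - var ((T b)^[n] μ))) atTop (𝓝 √(b - 1)) := by
    have := (tendsto_var hμ).const_sub ((b : ℝ) - 1)
    rw [sub_zero] at this
    exact (Real.continuous_sqrt.tendsto _).comp this
  refine h.congr fun n => ?_
  have hs := sigma_pos hμ n
  have hs' := sigma_pos hμ (n + 1)
  rw [Real.sqrt_eq_iff_mul_self_eq (by linarith [var_lt_of_mem_P (iterate_T_mem_P hμ n)])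
    (by positivity), ← sq, div_pow, sigma_sq_eq_mul hμ, mul_div_cancel_right₀ _ (by positivity)]

/-- Variances add up: `b ((b - 1) / b ^ 2 + 1 / b ^ 2) = 1`. -/
theorem charFun_gaussian_eq_pow (hb : 3 ≤ b) (s : ℝ) :
    charFun (gaussianReal 0 1) s = (charFun (gaussianReal 0 1) (√(b - 1) * (s / b)) *
      charFun (gaussianReal 0 1) (s / b)) ^ b := by
  have hb' : (3 : ℝ) ≤ b := by exact_mod_cast hb
  have hbc : (b : ℂ) ≠ 0 := by exact_mod_cast (by omega : b ≠ 0)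
  have hsq : ((√((b : ℝ) - 1) : ℝ) : ℂ) ^ 2 = b - 1 := by
    rw [← Complex.ofReal_pow, Real.sq_sqrt (by linarith)]
    push_cast
    ring
  simp only [charFun_gaussianReal]
  rw [← Complex.exp_add, ← Complex.exp_nat_mul]
  congr 1
  push_cast
  rw [mul_pow, hsq]
  field_simp
  ring

theorem norm_stdCf_succ_sub_le (hμ : μ ∈ P b) (n : ℕ) (s : ℝ) :
    ‖stdCf b μ (n + 1) s - charFun (gaussianReal 0 1) s‖ ≤
      |s| * (|sigma b μ n / sigma b μ (n + 1) - √(b - 1)| + sigma b μ n) +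
      b * (‖stdCf b μ n (√(b - 1) * (s / b)) -
          charFun (gaussianReal 0 1) (√(b - 1) * (s / b))‖ +
        ‖stdCf b μ (n + 1) (s / b) - charFun (gaussianReal 0 1) (s / b)‖) := by
  have hb := three_le_of_mem_P hμ
  have hb' : (0 : ℝ) < b := by exact_mod_cast (by omega : 0 < b)
  rw [stdCf_succ hμ, charFun_gaussian_eq_pow hb s]
  have hG (u : ℝ) : ‖charFun (gaussianReal 0 1) u‖ ≤ 1 := norm_charFun_le_one u
  have key := norm_integral_prod_sub_mul_stdCf_le hμ n √(b - 1) (s / b)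
  set ψ := ∫ p : ℝ≥0 × ℝ≥0, Complex.exp ((s / b : ℝ) *
      (((p.1 : ℝ) * p.2 - 1) / sigma b μ (n + 1) : ℝ) * Complex.I)
        ∂(((T b)^[n] μ : Measure ℝ≥0).prod ((T b)^[n + 1] μ : Measure ℝ≥0)) with hψ
  have hψ1 : ‖ψ‖ ≤ 1 := (norm_integral_le_of_norm_le_const (C := 1)
    (ae_of_all _ fun _ => (norm_cexp_mul_I _ _).le)).trans (by simp)
  set A := stdCf b μ n (√(b - 1) * (s / b))
  set A' := stdCf b μ (n + 1) (s / b)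
  set G := charFun (gaussianReal 0 1) (√(b - 1) * (s / b))
  set G' := charFun (gaussianReal 0 1) (s / b)
  have hprod : ‖A * A' - G * G'‖ ≤ ‖A - G‖ + ‖A' - G'‖ := by
    have e : A * A' - G * G' = (A - G) * A' + G * (A' - G') := by ring
    rw [e]
    refine (norm_add_le _ _).trans ?_
    rw [norm_mul, norm_mul]
    exact add_le_add (mul_le_of_le_one_right (norm_nonneg _) (norm_stdCf_le_one _ _))
      (mul_le_of_le_one_left (norm_nonneg _) (hG _))
  have hGG : ‖G * G'‖ ≤ 1 := by
    rw [norm_mul]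
    exact mul_le_one₀ (hG _) (norm_nonneg _) (hG _)
  calc _ ≤ b * ‖ψ - G * G'‖ := norm_pow_sub_pow_le_mul hψ1 hGG b
    _ ≤ b * (‖ψ - A * A'‖ + ‖A * A' - G * G'‖) := by
        gcongr
        exact norm_sub_le_norm_sub_add_norm_sub _ _ _
    _ ≤ b * (|s / b| * (|sigma b μ n / sigma b μ (n + 1) - √(b - 1)| + sigma b μ n) +
        (‖A - G‖ + ‖A' - G'‖)) := by gcongr
    _ = _ := by
        rw [abs_div, abs_of_pos hb']
        field_simp

/-- At exponent 2 the sum is exactly 1 by variance conservation; both bases lie in `(0, 1)`, so a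
larger exponent strictly decreases it. -/
theorem mul_rpow_add_rpow_lt_one (hb : 3 ≤ b) {q : ℝ} (hq : 2 < q) :
    b * ((√((b : ℝ) - 1) / b) ^ q + (1 / (b : ℝ)) ^ q) < 1 := by
  have hb' : (3 : ℝ) ≤ b := by exact_mod_cast hb
  have hg2 : √((b : ℝ) - 1) ^ 2 = b - 1 := Real.sq_sqrt (by linarith)
  have hg0 : 0 < √((b : ℝ) - 1) := Real.sqrt_pos.2 (by linarith)
  have hlt {x : ℝ} (hx0 : 0 < x) (hx1 : x < 1) : x ^ q < x ^ 2 := by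
    rw [← Real.rpow_natCast]
    exact Real.rpow_lt_rpow_of_exponent_gt hx0 hx1 (by simpa using hq)
  have h1 := hlt (x := √((b : ℝ) - 1) / b) (by positivity)
    (by rw [div_lt_one (by linarith)]; nlinarith)
  have h2 := hlt (x := 1 / (b : ℝ)) (by positivity) (by rw [div_lt_one (by linarith)]; linarith)
  have e : (b : ℝ) * ((√((b : ℝ) - 1) / b) ^ 2 + (1 / (b : ℝ)) ^ 2) = 1 := by
    rw [div_pow, hg2]
    field_simp
    ring
  refine lt_of_lt_of_eq ?_ e
  gcongr

theorem tendsto_stdCf (hμ : μ ∈ P b)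
    (hp : ∃ p : ℝ, 2 < p ∧ (⨆ n ≥ 1, normalizedMoment b μ p n) < ⊤) (s : ℝ) :
    Tendsto (fun n => stdCf b μ n s) atTop (𝓝 (charFun (gaussianReal 0 1) s)) := by
  obtain ⟨p, hp2, hp⟩ := hp
  have hb := three_le_of_mem_P hμ
  have hb' : (3 : ℝ) ≤ b := by exact_mod_cast hb
  set q := min p 3
  have hq2 : 2 < q := lt_min hp2 (by norm_num)
  obtain ⟨K₁, hK₁, hφ⟩ := stdCf_taylor_bound hμ hq2.le (min_le_right _ _) (min_le_left _ _) hp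
  obtain ⟨K₂, hK₂, hG⟩ := gaussian_taylor_bound hq2.le (min_le_right p 3)
  set κ := b * ((√((b : ℝ) - 1) / b) ^ q + (1 / (b : ℝ)) ^ q) with hκ
  have hκ1 : κ < 1 := mul_rpow_add_rpow_lt_one hb hq2
  have hκ0 : 0 ≤ κ := by positivity
  set Δ : ℕ → ℝ → ℝ := fun n s => ‖stdCf b μ n s - charFun (gaussianReal 0 1) s‖ with hΔ
  have hlim0 : Tendsto (fun n => |sigma b μ n / sigma b μ (n + 1) - √(b - 1)| + sigma b μ n)
      atTop (𝓝 0) := by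
    have h1 := ((tendsto_sigma_div hμ).sub_const √((b : ℝ) - 1)).abs
    simpa using h1.add (tendsto_sigma hμ)
  -- Applying the approximate functional equation `m` times gains `κ ^ m`. For fixed `m` and `s`
  -- only finitely many arguments are involved, so no uniformity in `s` of the threshold on `n` is
  -- required.
  have key (m : ℕ) : ∀ s ε, 0 < ε → ∀ᶠ n in atTop, Δ n s ≤ (K₁ + K₂) * κ ^ m * |s| ^ q + ε := by
    induction m with
    | zero =>
      intro s ε hε
      filter_upwards [eventually_ge_atTop 1] with n hn
      have e : stdCf b μ n s - charFun (gaussianReal 0 1) s =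
          (stdCf b μ n s - 1 + s ^ 2 / 2) - (charFun (gaussianReal 0 1) s - 1 + s ^ 2 / 2) := by
        ring
      simp only [hΔ]
      rw [e]
      refine (norm_sub_le _ _).trans ?_
      have := hφ n hn s
      have := hG s
      rw [pow_zero, mul_one, add_mul]
      linarith
    | succ m ih =>
      intro s ε hε
      -- Two differences multiplied by `b` consume `ε / 2`; the linearization error takes the other
      -- half.
      have hε' : 0 < ε / (4 * b) := by positivity
      have h1 := ih (√(b - 1) * (s / b)) _ hε'
      -- The second difference sits at time `n + 1`, the same time as the left-hand side, but at the
      -- smaller argument `s / b`, so the induction hypothesis is shifted.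
      have h2 := (tendsto_add_atTop_nat 1).eventually (ih (s / b) _ hε')
      have h3 : ∀ᶠ n in atTop,
          |s| * (|sigma b μ n / sigma b μ (n + 1) - √(b - 1)| + sigma b μ n) ≤ ε / 2 := by
        have := hlim0.const_mul |s|
        rw [mul_zero] at this
        exact this.eventually_le_const (by positivity)
      rw [← map_add_atTop_eq_nat 1, eventually_map]
      filter_upwards [h1, h2, h3] with n h1 h2 h3
      refine (norm_stdCf_succ_sub_le hμ n s).trans ?_
      have e1 : |√(b - 1) * (s / b)| ^ q = (√(b - 1) / b) ^ q * |s| ^ q := by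
        rw [← Real.mul_rpow (by positivity) (abs_nonneg _), abs_mul, abs_div,
          abs_of_nonneg (Real.sqrt_nonneg _), abs_of_pos (by linarith : (0 : ℝ) < b)]
        congr 1
        ring
      have e2 : |s / b| ^ q = (1 / (b : ℝ)) ^ q * |s| ^ q := by
        rw [← Real.mul_rpow (by positivity) (abs_nonneg _), abs_div,
          abs_of_pos (by linarith : (0 : ℝ) < b)]
        congr 1
        ring
      rw [e1] at h1
      rw [e2] at h2
      have e3 : (b : ℝ) * (ε / (4 * b)) = ε / 4 := by field_simp
      have h12 := mul_le_mul_of_nonneg_left (add_le_add h1 h2) (by linarith : (0 : ℝ) ≤ b)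
      refine (add_le_add h3 h12).trans_eq ?_
      rw [pow_succ]
      nth_rewrite 3 [hκ]
      linear_combination 2 * e3
  rw [tendsto_iff_norm_sub_tendsto_zero]
  refine tendsto_order.2 ⟨fun a ha => Eventually.of_forall fun n => ha.trans_le (norm_nonneg _),
    fun a ha => ?_⟩
  have hpow : Tendsto (fun m : ℕ => (K₁ + K₂) * κ ^ m * |s| ^ q) atTop (𝓝 0) := by
    simpa using ((tendsto_pow_atTop_nhds_zero_of_lt_one hκ0 hκ1).const_mul (K₁ + K₂)).mul_const
      (|s| ^ q)
  obtain ⟨m, hm⟩ := (hpow.eventually_lt_const (half_pos ha)).exists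
  filter_upwards [key m s (a / 2) (half_pos ha)] with n hn
  exact hn.trans_lt (by linarith)

theorem tendstoInDistribution_std (hμ : μ ∈ P b)
    (hp : ∃ p : ℝ, 2 < p ∧ (⨆ n ≥ 1, normalizedMoment b μ p n) < ⊤)
    {Ω : ℕ → Type*} [∀ n, MeasurableSpace (Ω n)] {Q : ∀ n, Measure (Ω n)}
    [∀ n, IsProbabilityMeasure (Q n)] {W : ∀ n, Ω n → ℝ≥0}
    (hW : ∀ n, HasLaw (W n) ((T b)^[n] μ : Measure ℝ≥0) (Q n)) :
    TendstoInDistribution (fun n ω => ((W n ω : ℝ) - 1) / sigma b μ n) atTop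
      (id : ℝ → ℝ) Q (gaussianReal 0 1) := by
  have hm (n : ℕ) : AEMeasurable (fun ω => ((W n ω : ℝ) - 1) / sigma b μ n) (Q n) :=
    (by fun_prop : Measurable fun x : ℝ≥0 => ((x : ℝ) - 1) / sigma b μ n).comp_aemeasurable
      (hW n).aemeasurable
  refine ⟨hm, aemeasurable_id, ?_⟩
  refine ProbabilityMeasure.tendsto_of_tendsto_charFun fun s => ?_
  change Tendsto (fun n => charFun ((Q n).map fun ω => ((W n ω : ℝ) - 1) / sigma b μ n) s) atTop
    (𝓝 (charFun ((gaussianReal 0 1).map id) s))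
  rw [Measure.map_id]
  refine (tendsto_stdCf hμ hp s).congr fun n => ?_
  rw [stdCf, ← (hW n).map_eq, integral_map (hW n).aemeasurable (by fun_prop), charFun_apply_real,
    integral_map (hm n) (by fun_prop)]

end Standardized

end Mandelbrot

theorem theorem1 (b : ℕ) (hb : 3 ≤ b) (μ : ProbabilityMeasure ℝ≥0) (hμ : μ ∈ Mandelbrot.P b) :
    -- all iterates are well defined: they stay in `𝒫_b` and the limits defining them exist
    (∀ n : ℕ, (Mandelbrot.T b)^[n] μ ∈ Mandelbrot.P b ∧
      Tendsto (fun k : ℕ => (Mandelbrot.smoothing b ((Mandelbrot.T b)^[n] μ))^[k] (diracProba 1))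
        atTop (𝓝 ((Mandelbrot.T b)^[n + 1] μ))) ∧
    -- (1)
    ((∃ c : ℝ, 0 < c ∧
        Tendsto (fun n : ℕ => ((b : ℝ) - 1) ^ ((n : ℝ) / 2) * Mandelbrot.sigma b μ n)
          atTop (𝓝 c)) ∧
      Tendsto (fun n : ℕ => (Mandelbrot.T b)^[n] μ) atTop (𝓝 (diracProba 1))) ∧
    -- (2)
    (μ ∈ Mandelbrot.D b → (⨆ n ≥ 1, Mandelbrot.normalizedMoment b μ 3 n) < ⊤) ∧
    -- (3)
    ((∃ p : ℝ, 2 < p ∧ (⨆ n ≥ 1, Mandelbrot.normalizedMoment b μ p n) < ⊤) →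
      ∀ (Ω : ℕ → Type*) [∀ n, MeasurableSpace (Ω n)] (Q : ∀ n, Measure (Ω n))
        [∀ n, IsProbabilityMeasure (Q n)] (W : ∀ n, Ω n → ℝ≥0),
        (∀ n, HasLaw (W n) ((Mandelbrot.T b)^[n] μ : Measure ℝ≥0) (Q n)) →
        TendstoInDistribution (fun n ω => ((W n ω : ℝ) - 1) / Mandelbrot.sigma b μ n) atTop
          (id : ℝ → ℝ) Q (gaussianReal 0 1)) := by
  refine ⟨fun n => ⟨Mandelbrot.iterate_T_mem_P hμ n, ?_⟩,
    ⟨Mandelbrot.tendsto_rpow_mul_sigma hμ, Mandelbrot.tendsto_iterate_T hμ⟩,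
    Mandelbrot.iSup_normalizedMoment_three_lt_top,
    fun hp Ω _ Q _ W hW => Mandelbrot.tendstoInDistribution_std hμ hp hW⟩
  rw [Function.iterate_succ_apply']
  exact Mandelbrot.tendsto_iterate_smoothing (Mandelbrot.iterate_T_mem_P hμ n)
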